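/- Let $d\ge 2$, let $\mathcal H_1,\dots,\mathcal H_d$ be separable real Hilbert spaces and $\mathcal H=\mathcal H_1\otimes\cdots\otimes\mathcal H_d$ their Hilbert tensor product with its canonical norm. Let $\mathbb T$ be a binary dimension tree: its root is $\{1,\dots,d\}$, each interior node is the disjoint union of its two sons, and the leaves are singletons. With $[n]:=\{1,\dots,d\}\setminus n$, let $\{n_t,[n_t]\}$, $t=1,\dots,E$, be an enumeration without repetition of the set of edges $\{\{n,[n]\}: n\in\mathbb T\setminus\{\{1,\dots,d\}\}\}$. For $\mathbf u\in\mathcal H$ let $\mathcal M_t(\mathbf u):\bigotimes_{i\in[n_t]}\mathcal H_i\to\bigotimes_{i\in n_t}\mathcal H_i$ be the corresponding matricization (a Hilbert–Schmidt operator), $\sigma_t(\mathbf u)=(\sigma_{t,k}(\mathbf u))_{k\ge1}$ its nonincreasing sequence of singular values (extended by zero if there are only finitely many), and $\mathrm{rank}_t(\mathbf u):=\mathrm{rank}\,\mathcal M_t(\mathbf u)$. For $\alpha>0$ let $s_\alpha(x)=\mathrm{sgn}(x)\max\{|x|-\alpha,0\}$, and for a Hilbert–Schmidt operator with singular value decomposition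 $X=\sum_k\sigma_k\langle V_k,\cdot\rangle U_k$ let $S_\alpha(X)=\sum_k s_\alpha(\sigma_k)\langle V_k,\cdot\rangle U_k$. Put $S_{t,\alpha}:=\mathcal M_t^{-1}\circ S_\alpha\circ\mathcal M_t$ and $\mathbf S_\alpha:=S_{E,\alpha}\circ\cdots\circ S_{1,\alpha}$. For a real sequence $a$ with $n$-th largest absolute value $a_n^*$ let $|a|_{w\ell_p}:=\sup_{n\ge1}n^{1/p}a_n^*$, and let $a\in w\ell_p$ mean that this is finite. (a) For each $p\in(0,2)$ there is a constant $C_p>0$, depending only on $p$, such that in every setting as above, for all $\mathbf v,\mathbf w\in\mathcal H$, $\varepsilon>0$, $\alpha>0$ with $\|\mathbf v-\mathbf w\|\le\varepsilon$ and all $t\in\{1,\dots,E\}$ with $\sigma_t(\mathbf v)\in w\ell_p$, $$\mathrm{rank}_t(\mathbf S_\alpha(\mathbf w))\le\frac{4\varepsilon^2}{\alpha^2}+C_p\,|\sigma_t(\mathbf v)|_{w\ell_p}^p\,\alpha^{-p}.$$ (b) If $\mathbf v,\mathbf w\in\mathcal H$, $\varepsilon>0$, $\alpha>0$, $\|\mathbf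 v-\mathbf w\|\le\varepsilon$, and for some $t\in\{1,\dots,E\}$ and $C,c,\beta>0$ one has $\sigma_{t,k}(\mathbf v)\le Ce^{-ck^\beta}$ for all $k\ge1$, then $$\mathrm{rank}_t(\mathbf S_\alpha(\mathbf w))\le\frac{4\varepsilon^2}{\alpha^2}+\bigl(c^{-1}\max\{\ln(2C\alpha^{-1}),0\}\bigr)^{1/\beta}.$$ In particular, both ranks are finite. -/

import Mathlib

open scoped ENNReal

noncomputable section

/-! ## Hilbert tensor products -/

section HilbertTensor

/-- The index set of a (chosen) orthonormal basis of the Hilbert space `E`. -/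
def onbIndex (E : Type*) [NormedAddCommGroup E] [InnerProductSpace ℝ E] [CompleteSpace E] :
    Set E :=
  (exists_hilbertBasis ℝ E).choose

/-- A (chosen) orthonormal basis of the Hilbert space `E`. -/
def onb (E : Type*) [NormedAddCommGroup E] [InnerProductSpace ℝ E] [CompleteSpace E] :
    HilbertBasis (onbIndex E) ℝ E :=
  (exists_hilbertBasis ℝ E).choose_spec.choose

/-- The Hilbert tensor product `⨂ j, H j` of a finite family of Hilbert spaces. A tensor is given
by its square summable family of coefficients with respect to the product of orthonormal bases of
the factors. The elementary tensors are `HilbertTensor.tprod`; the facts `inner_tprod` and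
`dense_span_tprod` below characterise the Hilbert tensor product up to isometric isomorphism. -/
abbrev HilbertTensor {κ : Type*} (H : κ → Type*) [∀ j, NormedAddCommGroup (H j)]
    [∀ j, InnerProductSpace ℝ (H j)] [∀ j, CompleteSpace (H j)] : Type _ :=
  lp (fun _ : (∀ j, onbIndex (H j)) => ℝ) 2

theorem memlp_two_iff_summable_sq {ι : Type*} {f : ι → ℝ} :
    Memℓp f 2 ↔ Summable fun i => f i ^ 2 := by
  rw [memℓp_gen_iff (by norm_num)]
  simp

theorem hasSum_mul_prod {α β : Type*} {f : α → ℝ} {g : β → ℝ} {s t : ℝ} (hf : HasSum f s)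
    (hg : HasSum g t) : HasSum (fun x : α × β => f x.1 * g x.2) (s * t) := by
  have h := summable_mul_of_summable_norm (f := f) (g := g) hf.summable.norm hg.summable.norm
  exact HasSum.mul hf hg h

/-- Auxiliary: products of convergent series indexed by `κ` can be multiplied out. -/
def ProdPiHasSum.{u, v} (κ : Type u) [Fintype κ] : Prop :=
  ∀ (ι : κ → Type v) (f : ∀ j, ι j → ℝ) (S : κ → ℝ), (∀ j, HasSum (f j) (S j)) →
    HasSum (fun k : (∀ j, ι j) => ∏ j, f j (k j)) (∏ j, S j)

theorem hasSum_prod_pi.{u, v} (κ : Type u) [Fintype κ] : ProdPiHasSum.{u, v} κ := by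
  refine Fintype.induction_empty_option (P := ProdPiHasSum.{u, v}) ?_ ?_ ?_ κ
  · intro α β _ e ih ι f S h
    let _ := Fintype.ofEquiv β e.symm
    have h2 := ih (fun j => ι (e j)) (fun j => f (e j)) (fun j => S (e j)) fun j => h (e j)
    rw [← (Equiv.piCongrLeft ι e).hasSum_iff, ← Equiv.prod_comp e S]
    have h1 : (fun k : (∀ j, ι j) => ∏ j, f j (k j)) ∘ Equiv.piCongrLeft ι e =
        fun k => ∏ j, f (e j) (k j) := by
      funext k
      rw [Function.comp_apply, ← Equiv.prod_comp e]
      exact Finset.prod_congr rfl fun j _ => by rw [Equiv.piCongrLeft_apply_apply]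
    rw [h1]
    exact h2
  · intro ι f S _
    simp
  · intro α _ ih ι f S h
    have h2 := ih (fun j => ι (some j)) (fun j => f (some j)) (fun j => S (some j))
      fun j => h (some j)
    have h3 := hasSum_mul_prod (h none) h2
    rw [← Equiv.piOptionEquivProd.hasSum_iff] at h3
    rw [Fintype.prod_option]
    have h1 : (fun k : (∀ j, ι j) => ∏ j, f j (k j)) =
        (fun x : ι none × (∀ j, ι (some j)) => f none x.1 * ∏ j, f (some j) (x.2 j)) ∘
          Equiv.piOptionEquivProd := by
      funext k
      rw [Function.comp_apply, Fintype.prod_option]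
      rfl
    rw [h1]
    exact h3

end HilbertTensor

namespace HilbertTensor

variable {κ : Type*} [Fintype κ] {H : κ → Type*} [∀ j, NormedAddCommGroup (H j)]
    [∀ j, InnerProductSpace ℝ (H j)] [∀ j, CompleteSpace (H j)]

/-- The elementary tensor `⨂ j, x j`. -/
def tprod (x : ∀ j, H j) : HilbertTensor H :=
  ⟨fun k => ∏ j, inner ℝ (onb (H j) (k j)) (x j), by
    have h := hasSum_prod_pi _ _ (fun j (k : onbIndex (H j)) => inner ℝ (onb (H j) k) (x j) ^ 2) _
      fun j => ((onb (H j)).summable_inner_mul_inner (x j) (x j) |>.congr fun k => by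
        rw [real_inner_comm, sq]).hasSum
    refine memlp_two_iff_summable_sq.2 (h.summable.congr fun k => ?_)
    rw [Finset.prod_pow]⟩

theorem inner_tprod (x y : ∀ j, H j) :
    inner ℝ (tprod x) (tprod y) = ∏ j, inner ℝ (x j) (y j) := by
  refine (lp.hasSum_inner (tprod x) (tprod y)).unique ?_
  have h := hasSum_prod_pi _ _ (fun j (k : onbIndex (H j)) =>
    inner ℝ (x j) (onb (H j) k) * inner ℝ (onb (H j) k) (y j)) _
      fun j => (onb (H j)).hasSum_inner_mul_inner (x j) (y j)
  have e : (fun k => inner ℝ (tprod x k) (tprod y k)) = fun k : (∀ j, onbIndex (H j)) =>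
      ∏ j, inner ℝ (x j) (onb (H j) (k j)) * inner ℝ (onb (H j) (k j)) (y j) := by
    funext k
    rw [Finset.prod_mul_distrib, mul_comm]
    refine (RCLike.inner_apply _ _).trans ?_
    simp [tprod, real_inner_comm]
  rw [e]
  exact h

theorem dense_span_tprod :
    Dense (Submodule.span ℝ (Set.range (tprod : (∀ j, H j) → HilbertTensor H)) :
      Set (HilbertTensor H)) := by
  classical
  have hb := (HilbertBasis.ofRepr (LinearIsometryEquiv.refl ℝ (HilbertTensor H))).dense_span
  rw [← Submodule.dense_iff_topologicalClosure_eq_top] at hb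
  refine hb.mono (Submodule.span_mono ?_)
  rintro _ ⟨k, rfl⟩
  refine ⟨fun j => onb (H j) (k j), ?_⟩
  ext l
  rw [← HilbertBasis.repr_symm_single]
  have e : (lp.single 2 k (1 : ℝ) : HilbertTensor H) l = if l = k then 1 else 0 := by
    rw [lp.coeFn_single, Pi.single_apply]
  refine Eq.trans ?_ e.symm
  simp [tprod, orthonormal_iff_ite.1 (onb _).orthonormal, funext_iff, Finset.prod_ite_zero]

end HilbertTensor


/-! ## Singular values, soft thresholding and ranks of operators -/

section Operators

variable {S₁ S₂ : Type*} [NormedAddCommGroup S₁] [InnerProductSpace ℝ S₁]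
    [NormedAddCommGroup S₂] [InnerProductSpace ℝ S₂]

/-- `X = ∑ₖ σₖ ⟨Vₖ, ·⟩ Uₖ` is a singular value decomposition of `X`: the sequence `σ` is
nonincreasing and nonnegative (zeros are appended if there are only finitely many nonzero singular
values), and the left and right singular vectors belonging to nonzero singular values are
orthonormal. -/
structure IsSVD (X : S₁ →L[ℝ] S₂) (σ : ℕ → ℝ) (U : ℕ → S₂) (V : ℕ → S₁) : Prop where
  antitone : Antitone σ
  nonneg : ∀ k, 0 ≤ σ k
  orthonormal_left : Orthonormal ℝ fun k : {k // σ k ≠ 0} => U k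
  orthonormal_right : Orthonormal ℝ fun k : {k // σ k ≠ 0} => V k
  hasSum : HasSum (fun k => σ k • InnerProductSpace.rankOne ℝ (U k) (V k)) X

open Classical in
/-- The sequence of singular values of an operator that has a singular value decomposition, in
particular of any Hilbert-Schmidt operator. The largest singular value has index `0`. -/
def singularValues (X : S₁ →L[ℝ] S₂) : ℕ → ℝ :=
  if h : ∃ σ U V, IsSVD X σ U V then h.choose else 0

/-- Soft thresholding of a real number. -/
def softThreshold (α x : ℝ) : ℝ := Real.sign x * max (|x| - α) 0

open Classical in
/-- Soft thresholding of an operator: if `X = ∑ₖ σₖ ⟨Vₖ, ·⟩ Uₖ` is a singular value decomposition,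
then the result is `∑ₖ s_α(σₖ) ⟨Vₖ, ·⟩ Uₖ`. -/
def softThresholdOp (α : ℝ) (X : S₁ →L[ℝ] S₂) : S₁ →L[ℝ] S₂ :=
  if h : ∃ D : (ℕ → ℝ) × (ℕ → S₂) × (ℕ → S₁), IsSVD X D.1 D.2.1 D.2.2 then
    ∑' k, softThreshold α (h.choose.1 k) •
      InnerProductSpace.rankOne ℝ (h.choose.2.1 k) (h.choose.2.2 k)
  else 0

/-- The rank of an operator, with value `⊤` for operators of infinite rank. -/
def opRank (X : S₁ →L[ℝ] S₂) : ℕ∞ := Cardinal.toENat (LinearMap.rank (X : S₁ →ₗ[ℝ] S₂))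

end Operators

/-! ## Weak-`ℓ_p` spaces -/

/-- The nonincreasing rearrangement of the absolute values of a sequence; `n` is counted from `0`,
so this is the `(n+1)`-st largest value of `|a k|`. -/
def rearrangement (a : ℕ → ℝ) (n : ℕ) : ℝ≥0∞ :=
  sInf {s : ℝ≥0∞ | {k | s < ENNReal.ofReal |a k|}.encard ≤ n}

/-- The weak-`ℓ_p` quasi-norm `sup_{n ≥ 1} n^{1/p} a*_n`, possibly infinite. -/
def weakLpNorm (p : ℝ) (a : ℕ → ℝ) : ℝ≥0∞ :=
  ⨆ n : ℕ, ((n + 1 : ℕ) : ℝ≥0∞) ^ (1 / p) * rearrangement a n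

/-- Membership in weak-`ℓ_p`. -/
def MemWeakLp (p : ℝ) (a : ℕ → ℝ) : Prop := weakLpNorm p a < ∞

/-! ## Dimension trees -/

/-- `IsDimensionTree r T`: `T` is the set of nodes of a binary dimension tree with root `r`. The
leaves are singletons, and each interior node is the disjoint union of its two sons. -/
inductive IsDimensionTree {d : ℕ} : Finset (Fin d) → Finset (Finset (Fin d)) → Prop
  | leaf (i : Fin d) : IsDimensionTree {i} {{i}}
  | node {a b : Finset (Fin d)} {A B : Finset (Finset (Fin d))} (ha : IsDimensionTree a A)
      (hb : IsDimensionTree b B) (hab : Disjoint a b) :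
      IsDimensionTree (a ∪ b) (insert (a ∪ b) (A ∪ B))

/-- The set of edges `{n, [n]}` for nodes `n ≠ {1, …, d}` of `T`, where `[n]` is the complement. -/
def treeEdges {d : ℕ} (T : Finset (Finset (Fin d))) : Finset (Finset (Finset (Fin d))) :=
  (T.erase Finset.univ).image fun n => {n, nᶜ}

/-- `{n t, [n t]}`, for `t` ranging over `Fin E`, is an enumeration without repetition of the edges
of the tree `T`. -/
def IsEdgeEnumeration {d E : ℕ} (T : Finset (Finset (Fin d))) (n : Fin E → Finset (Fin d)) : Prop :=
  Set.BijOn (fun t => ({n t, (n t)ᶜ} : Finset (Finset (Fin d)))) Set.univ (treeEdges T)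

/-! ## Matricizations and soft thresholding of hierarchical tensors -/

section Hierarchical

variable {d : ℕ} {H : Fin d → Type*} [∀ j, NormedAddCommGroup (H j)]
    [∀ j, InnerProductSpace ℝ (H j)] [∀ j, CompleteSpace (H j)]

/-- Combine multi-indices for the modes in `n` and for the modes not in `n`. -/
def mergeIndex (n : Finset (Fin d)) :
    ((∀ j : {j // j ∈ n}, onbIndex (H j)) × (∀ j : {j // j ∉ n}, onbIndex (H j))) ≃
      (∀ j, onbIndex (H j)) :=
  (Equiv.piEquivPiSubtypeProd (· ∈ n) fun j => onbIndex (H j)).symm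

theorem summable_sq_merge (n : Finset (Fin d)) (u : HilbertTensor H) :
    Summable fun q : (∀ j : {j // j ∈ n}, onbIndex (H j)) × (∀ j : {j // j ∉ n}, onbIndex (H j)) =>
      u (mergeIndex n q) ^ 2 :=
  (mergeIndex n).summable_iff (f := fun k => u k ^ 2) |>.2
    (memlp_two_iff_summable_sq.1 (lp.memℓp u))

/-- The row with index `k` of the matricization of `u`. -/
def matRow (n : Finset (Fin d)) (u : HilbertTensor H) (k : ∀ j : {j // j ∈ n}, onbIndex (H j)) :
    HilbertTensor (fun j : {j // j ∉ n} => H j) :=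
  ⟨fun l => u (mergeIndex n (k, l)),
    memlp_two_iff_summable_sq.2 ((summable_sq_merge n u).prod_factor k)⟩

theorem norm_matRow_sq (n : Finset (Fin d)) (u : HilbertTensor H)
    (k : ∀ j : {j // j ∈ n}, onbIndex (H j)) :
    ‖matRow n u k‖ ^ 2 = ∑' l, u (mergeIndex n (k, l)) ^ 2 := by
  have h := lp.norm_rpow_eq_tsum (p := 2) (by norm_num) (matRow n u k)
  simpa [matRow] using h

theorem hasSum_norm_matRow_sq (n : Finset (Fin d)) (u : HilbertTensor H) :
    HasSum (fun k => ‖matRow n u k‖ ^ 2) (‖u‖ ^ 2) := by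
  have h : HasSum (fun k => u k ^ 2) (‖u‖ ^ 2) := by
    simpa using lp.hasSum_norm (p := 2) (by norm_num) u
  rw [← (mergeIndex n).hasSum_iff] at h
  simp only [norm_matRow_sq]
  exact h.prod_fiberwise fun k => ((summable_sq_merge n u).prod_factor k).hasSum

theorem matMul_sq_le (n : Finset (Fin d)) (u : HilbertTensor H)
    (a : HilbertTensor (fun j : {j // j ∉ n} => H j)) (k : ∀ j : {j // j ∈ n}, onbIndex (H j)) :
    inner ℝ (matRow n u k) a ^ 2 ≤ ‖matRow n u k‖ ^ 2 * ‖a‖ ^ 2 := by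
  rw [← mul_pow, sq_le_sq, abs_of_nonneg (by positivity : 0 ≤ ‖matRow n u k‖ * ‖a‖)]
  exact abs_real_inner_le_norm _ _

theorem memlp_matMul (n : Finset (Fin d)) (u : HilbertTensor H)
    (a : HilbertTensor (fun j : {j // j ∉ n} => H j)) :
    Memℓp (fun k : (∀ j : {j // j ∈ n}, onbIndex (H j)) => inner ℝ (matRow n u k) a) 2 :=
  memlp_two_iff_summable_sq.2 <|
    Summable.of_nonneg_of_le (fun _ => sq_nonneg _) (matMul_sq_le n u a)
      ((hasSum_norm_matRow_sq n u).summable.mul_right _)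

/-- The matricization of the tensor `u` with respect to `n`, as an operator
`⨂_{j ∉ n} H j → ⨂_{j ∈ n} H j`. Its matrix entry in row `k` and column `l` is the coefficient of
`u` with the combined multi-index; so the row `k` is applied to `a` as an inner product. -/
def matricization (n : Finset (Fin d)) (u : HilbertTensor H) :
    HilbertTensor (fun j : {j // j ∉ n} => H j) →L[ℝ] HilbertTensor (fun j : {j // j ∈ n} => H j) :=
  LinearMap.mkContinuous
    { toFun := fun a => ⟨fun k => inner ℝ (matRow n u k) a, memlp_matMul n u a⟩
      map_add' := fun a b => by
        ext k
        exact inner_add_right _ _ _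
      map_smul' := fun c a => by
        ext k
        exact real_inner_smul_right _ _ _ }
    ‖u‖ fun a => by
      refine le_of_sq_le_sq ?_ (by positivity)
      rw [mul_pow]
      refine hasSum_le (matMul_sq_le n u a) ?_ ((hasSum_norm_matRow_sq n u).mul_right _)
      simpa using lp.hasSum_norm (p := 2) (by norm_num)
        (⟨fun k => inner ℝ (matRow n u k) a, memlp_matMul n u a⟩ :
          HilbertTensor (fun j : {j // j ∈ n} => H j))

theorem matricization_single [∀ j, DecidableEq (onbIndex (H j))] (n : Finset (Fin d))
    (u : HilbertTensor H) (k : ∀ j : {j // j ∈ n}, onbIndex (H j))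
    (l : ∀ j : {j // j ∉ n}, onbIndex (H j)) :
    matricization n u (lp.single 2 l (1 : ℝ)) k = u (mergeIndex n (k, l)) := by
  refine (lp.inner_single_right (𝕜 := ℝ)
    (G := fun _ : (∀ j : {j // j ∉ n}, onbIndex (H j)) => ℝ) l (1 : ℝ) (matRow n u k)).trans ?_
  exact (RCLike.inner_apply _ _).trans (one_mul _)

theorem matricization_injective (n : Finset (Fin d)) :
    Function.Injective (matricization n : HilbertTensor H → _) := by
  classical
  intro u v h
  ext q
  obtain ⟨⟨k, l⟩, rfl⟩ := (mergeIndex n).surjective q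
  rw [← matricization_single, ← matricization_single, h]

/-- The singular values `σ_{t,k}(u)` of the matricization at an edge `{n, [n]}`; `k` is counted
from `0`. -/
def tensorSingularValues (n : Finset (Fin d)) (u : HilbertTensor H) : ℕ → ℝ :=
  singularValues (matricization n u)

/-- The rank of the matricization at an edge `{n, [n]}`. -/
def tensorRank (n : Finset (Fin d)) (u : HilbertTensor H) : ℕ∞ := opRank (matricization n u)

/-- Soft thresholding `M⁻¹ ∘ S_α ∘ M` of the matricization of a tensor; `M` is injective, and its
range, the Hilbert-Schmidt operators, contains `S_α (M u)`. -/
def tensorSoftThreshold (n : Finset (Fin d)) (α : ℝ) (u : HilbertTensor H) : HilbertTensor H :=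
  Function.invFun (matricization n) (softThresholdOp α (matricization n u))

/-- The hierarchical soft thresholding `S_{E,α} ∘ ⋯ ∘ S_{1,α}`. -/
def hierSoftThreshold {E : ℕ} (n : Fin E → Finset (Fin d)) (α : ℝ) (u : HilbertTensor H) :
    HilbertTensor H :=
  (List.finRange E).foldl (fun w t => tensorSoftThreshold (n t) α w) u

end Hierarchical

end

/-! The rank bound is a count of singular values at the level `α / 2`. Let `m` be the number of
singular values of `v` at the edge `t` that exceed `α / 2`. Tree nodes are pairwise nested or
disjoint, so thresholding at any edge `s` acts on the matricization at `t` as composition with a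
contraction, on the left or on the right (`exists_contraction_matricization_tensorSoftThreshold`).
Hence the edges before `t` keep the image of `v` approximable by `m` functionals at level `α / 2`,
and the edges after `t` cannot raise a rank. Each thresholding is also nonexpansive, as a proximal
map (`norm_tensorSoftThreshold_sub_le`), so the images of `v` and `w` reach the edge `t` at distance
at most `ε`.

At `t` itself, the new rank is at most the number `r` of singular values of the image of `w` above
`α`. On the span of their right singular vectors that operator expands by at least `α`. Inside this
span, a subspace of dimension at least `r - m` has the image of `v` bounded by `α / 2`. There the
difference is at least `α / 2`, so its Hilbert-Schmidt norm gives `(r - m) α² / 4 ≤ ε²`, that is `r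
≤ 4 ε² / α² + m`. Both parts of the theorem follow by bounding `m` from the assumed decay.

Singular value decompositions are constructed from compactness of matricizations, by repeatedly
removing the leading term. -/

open scoped ENNReal

noncomputable section

/-! ### Singular value decompositions, approximation by functionals, finite rank -/

section SingularValueDecomposition

open InnerProductSpace

variable {S₁ S₂ : Type*} [NormedAddCommGroup S₁] [InnerProductSpace ℝ S₁]
    [NormedAddCommGroup S₂] [InnerProductSpace ℝ S₂]

/-- Pythagoras. An SVD leaves the vectors with `σ k = 0` arbitrary, so the coefficients have to
vanish there. -/
theorem norm_sq_sum_smul_of_inner_eq_ite {S : Type*} [NormedAddCommGroup S]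
    [InnerProductSpace ℝ S] {σ : ℕ → ℝ} {U : ℕ → S}
    (hU : Orthonormal ℝ fun k : {k // σ k ≠ 0} => U k) {d : ℕ → ℝ} (s : Finset ℕ)
    (hd : ∀ k, σ k = 0 → d k = 0) : ‖∑ k ∈ s, d k • U k‖ ^ 2 = ∑ k ∈ s, d k ^ 2 := by
  rw [← real_inner_self_eq_norm_sq, sum_inner]
  refine Finset.sum_congr rfl fun k hk => ?_
  rw [inner_sum, Finset.sum_eq_single k]
  · by_cases h : σ k = 0
    · simp [hd k h]
    · rw [real_inner_smul_left, real_inner_smul_right, real_inner_self_eq_norm_sq,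
        hU.1 ⟨k, h⟩]
      ring
  · intro j _ hjk
    by_cases h : σ k = 0
    · simp [hd k h]
    by_cases h' : σ j = 0
    · simp [hd j h']
    have := hU.2 (i := ⟨k, h⟩) (j := ⟨j, h'⟩) fun e => hjk (congrArg Subtype.val e).symm
    rw [real_inner_smul_left, real_inner_smul_right]
    simp only [] at this
    rw [this]; simp
  · exact fun h => absurd hk h

theorem sum_sq_inner_le {σ : ℕ → ℝ} {V : ℕ → S₁}
    (hV : Orthonormal ℝ fun k : {k // σ k ≠ 0} => V k) (s : Finset ℕ) (x : S₁) :
    ∑ k ∈ s with σ k ≠ 0, inner ℝ (V k) x ^ 2 ≤ ‖x‖ ^ 2 := by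
  have h := hV.sum_inner_products_le x (s := s.subtype fun k => σ k ≠ 0)
  rw [Finset.sum_subtype_eq_sum_filter (f := fun k => ‖inner ℝ (V k) x‖ ^ 2)] at h
  simpa using h

/-- Pythagoras on the left, Bessel on the right. The coefficients `c` are free, to cover
thresholding residuals and diagonal contractions; the alternative `inner ℝ (V k) x = 0` serves
vectors orthogonal to the leading `V k`. -/
theorem norm_sq_sum_rankOne_le {σ : ℕ → ℝ} {U : ℕ → S₂} {V : ℕ → S₁}
    (hU : Orthonormal ℝ fun k : {k // σ k ≠ 0} => U k)
    (hV : Orthonormal ℝ fun k : {k // σ k ≠ 0} => V k) {c : ℕ → ℝ} {τ : ℝ} {x : S₁}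
    (hc : ∀ k, σ k = 0 → c k = 0) (hτ : ∀ k, |c k| ≤ τ ∨ inner ℝ (V k) x = 0) (s : Finset ℕ) :
    ‖∑ k ∈ s, (c k • rankOne ℝ (U k) (V k)) x‖ ^ 2 ≤ τ ^ 2 * ‖x‖ ^ 2 := by
  have e : ∀ k ∈ s, (c k • rankOne ℝ (U k) (V k)) x = (c k * inner ℝ (V k) x) • U k := by
    intro k _
    rw [smul_apply, rankOne_apply, smul_smul]
  rw [Finset.sum_congr rfl e, norm_sq_sum_smul_of_inner_eq_ite hU]
  · rw [← Finset.sum_filter_of_ne (p := fun k => σ k ≠ 0)]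
    · refine le_trans ?_ (mul_le_mul_of_nonneg_left (sum_sq_inner_le hV s x) (sq_nonneg τ))
      rw [Finset.mul_sum]
      refine Finset.sum_le_sum fun k _ => ?_
      rcases hτ k with h | h
      · rw [mul_pow]
        exact mul_le_mul_of_nonneg_right (sq_le_sq' (neg_le_of_abs_le h) (le_of_abs_le h))
          (sq_nonneg _)
      · simp [h]
    · intro k _ h h0
      simp [hc k h0] at h
  · intro k h
    simp [hc k h]

theorem norm_hasSum_rankOne_le {σ : ℕ → ℝ} {U : ℕ → S₂} {V : ℕ → S₁}
    (hU : Orthonormal ℝ fun k : {k // σ k ≠ 0} => U k)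
    (hV : Orthonormal ℝ fun k : {k // σ k ≠ 0} => V k) {c : ℕ → ℝ} {τ : ℝ} (h0 : 0 ≤ τ)
    {X : S₁ →L[ℝ] S₂} (hX : HasSum (fun k => c k • rankOne ℝ (U k) (V k)) X)
    (hc : ∀ k, σ k = 0 → c k = 0) {x : S₁} (hτ : ∀ k, |c k| ≤ τ ∨ inner ℝ (V k) x = 0) :
    ‖X x‖ ≤ τ * ‖x‖ := by
  have h := hX.mapL (ContinuousLinearMap.apply ℝ S₂ x)
  simp only [ContinuousLinearMap.apply_apply] at h
  refine le_of_tendsto h.norm (Filter.Eventually.of_forall fun s => ?_)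
  refine le_of_sq_le_sq ?_ (by positivity)
  rw [mul_pow]
  exact norm_sq_sum_rankOne_le hU hV hc hτ s

namespace IsSVD

variable {X : S₁ →L[ℝ] S₂} {σ : ℕ → ℝ} {U : ℕ → S₂} {V : ℕ → S₁} (h : IsSVD X σ U V)
include h

theorem hasSum_apply (x : S₁) : HasSum (fun k => (σ k * inner ℝ (V k) x) • U k) (X x) := by
  have := h.hasSum.mapL (ContinuousLinearMap.apply ℝ S₂ x)
  simpa [smul_smul] using this

theorem norm_left {k : ℕ} (hk : σ k ≠ 0) : ‖U k‖ = 1 := h.orthonormal_left.1 ⟨k, hk⟩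

theorem norm_right {k : ℕ} (hk : σ k ≠ 0) : ‖V k‖ = 1 := h.orthonormal_right.1 ⟨k, hk⟩

theorem inner_left_eq_zero {j k : ℕ} (hj : σ j ≠ 0) (hk : σ k ≠ 0) (hjk : j ≠ k) :
    inner ℝ (U j) (U k) = 0 :=
  h.orthonormal_left.2 (i := ⟨j, hj⟩) (j := ⟨k, hk⟩) fun e => hjk (congrArg Subtype.val e)

theorem inner_right_eq_zero {j k : ℕ} (hj : σ j ≠ 0) (hk : σ k ≠ 0) (hjk : j ≠ k) :
    inner ℝ (V j) (V k) = 0 :=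
  h.orthonormal_right.2 (i := ⟨j, hj⟩) (j := ⟨k, hk⟩) fun e => hjk (congrArg Subtype.val e)

theorem apply_right {k : ℕ} (hk : σ k ≠ 0) : X (V k) = σ k • U k := by
  refine (h.hasSum_apply (V k)).unique ?_
  convert hasSum_single k ?_ using 1
  · rw [real_inner_self_eq_norm_sq, h.norm_right hk]; simp
  · intro j hj
    by_cases hj0 : σ j = 0
    · simp [hj0]
    · simp [h.inner_right_eq_zero hj0 hk hj]

theorem inner_left_apply {k : ℕ} (hk : σ k ≠ 0) (x : S₁) :
    inner ℝ (U k) (X x) = σ k * inner ℝ (V k) x := by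
  have h1 := (h.hasSum_apply x).mapL (innerSL ℝ (U k))
  simp only [innerSL_apply_apply, real_inner_smul_right] at h1
  refine h1.unique ?_
  convert hasSum_single k ?_ using 1
  · rw [real_inner_self_eq_norm_sq, h.norm_left hk]; simp
  · intro j hj
    by_cases hj0 : σ j = 0
    · simp [hj0]
    · simp [h.inner_left_eq_zero hk hj0 hj.symm]

/-- The terms of a convergent series tend to zero, and the `k`-th term has norm `σ k`. -/
theorem exists_le {τ : ℝ} (hτ : 0 < τ) : ∃ k, σ k ≤ τ := by
  have h1 := h.hasSum.summable.tendsto_atTop_zero.norm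
  rw [norm_zero] at h1
  obtain ⟨k, hk⟩ := (h1.eventually_lt_const hτ).exists
  refine ⟨k, ?_⟩
  by_cases h0 : σ k = 0
  · rw [h0]; exact hτ.le
  · rw [norm_smul, norm_rankOne, h.norm_left h0, h.norm_right h0] at hk
    rw [mul_one, mul_one] at hk
    exact (le_abs_self _).trans hk.le

/-- The number of singular values that exceed a threshold. -/
theorem exists_lt_iff {τ : ℝ} (hτ : 0 < τ) : ∃ m, ∀ k, τ < σ k ↔ k < m := by
  classical
  refine ⟨Nat.find (h.exists_le hτ), fun k => ⟨fun hk => ?_, fun hk => ?_⟩⟩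
  · by_contra! hle
    exact absurd (h.antitone hle) (not_le.2 (lt_of_le_of_lt (Nat.find_spec (h.exists_le hτ)) hk))
  · exact not_le.1 (Nat.find_min _ hk)

end IsSVD

/-- `X` is bounded by `τ` on the kernel of some `m` linear functionals, so at most `m` of its
singular values exceed `τ`. -/
def IsApproxBy (m : ℕ) (τ : ℝ) (X : S₁ →L[ℝ] S₂) : Prop :=
  ∃ L : S₁ →ₗ[ℝ] (Fin m → ℝ), ∀ x, L x = 0 → ‖X x‖ ≤ τ * ‖x‖

/-- Stability under contractions on either side is the reason for counting large singular values
through functionals: the product needs no decomposition of its own. -/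
theorem IsApproxBy.comp_left {m : ℕ} {τ : ℝ} {X : S₁ →L[ℝ] S₂} (h : IsApproxBy m τ X)
    {P : S₂ →L[ℝ] S₂} (hP : ‖P‖ ≤ 1) : IsApproxBy m τ (P ∘L X) := by
  obtain ⟨L, hL⟩ := h
  exact ⟨L, fun x hx => (P.le_of_opNorm_le hP _).trans (by simpa using hL x hx)⟩

theorem IsApproxBy.comp_right {m : ℕ} {τ : ℝ} (hτ : 0 ≤ τ) {X : S₁ →L[ℝ] S₂}
    (h : IsApproxBy m τ X) {Q : S₁ →L[ℝ] S₁} (hQ : ‖Q‖ ≤ 1) : IsApproxBy m τ (X ∘L Q) := by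
  obtain ⟨L, hL⟩ := h
  refine ⟨L ∘ₗ (Q : S₁ →ₗ[ℝ] S₁), fun x hx => (hL (Q x) hx).trans ?_⟩
  exact mul_le_mul_of_nonneg_left (by simpa using Q.le_of_opNorm_le hQ x) hτ

/-- The functionals are the inner products with `V 0, …, V (m - 1)`; on their common kernel only the
tail of the series acts. -/
theorem IsSVD.isApproxBy {X : S₁ →L[ℝ] S₂} {σ : ℕ → ℝ} {U : ℕ → S₂} {V : ℕ → S₁}
    (h : IsSVD X σ U V) {τ : ℝ} (hτ : 0 ≤ τ) {m : ℕ} (hm : ∀ k, m ≤ k → σ k ≤ τ) :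
    IsApproxBy m τ X := by
  refine ⟨LinearMap.pi fun k => (innerSL ℝ (V k) : S₁ →ₗ[ℝ] ℝ), fun x hx => ?_⟩
  refine norm_hasSum_rankOne_le h.orthonormal_left h.orthonormal_right hτ h.hasSum
    (fun _ => id) fun k => ?_
  rcases lt_or_ge k m with hk | hk
  · right
    simpa using congrFun hx ⟨k, hk⟩
  · left
    rw [abs_of_nonneg (h.nonneg k)]
    exact hm k hk

/-- If `r` singular values of `X` exceed `α` while at most `m` of those of `Y` exceed `τ`, then
`X - Y` is bounded below by `α - τ` on some subspace of dimension `r - m`. -/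
theorem IsSVD.exists_orthonormal_le_norm_sub {X Y : S₁ →L[ℝ] S₂} {σ : ℕ → ℝ} {U : ℕ → S₂}
    {V : ℕ → S₁} (h : IsSVD X σ U V) {α τ : ℝ} (hα : 0 < α) {r m : ℕ}
    (hr : ∀ k, k < r → α < σ k) (hY : IsApproxBy m τ Y) :
    ∃ (s : ℕ) (x : Fin s → S₁), r ≤ s + m ∧ Orthonormal ℝ x ∧
      ∀ i, α - τ ≤ ‖X (x i) - Y (x i)‖ := by
  obtain ⟨L, hL⟩ := hY
  have hσ : ∀ k : Fin r, σ k ≠ 0 := fun k => (hα.trans (hr k k.2)).ne'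
  have hV : Orthonormal ℝ fun k : Fin r => V k :=
    h.orthonormal_right.comp (fun k : Fin r => ⟨k, hσ k⟩) fun a b e => by
      simpa [Fin.ext_iff] using e
  let W := Submodule.span ℝ (Set.range fun k : Fin r => V k)
  have hW : Module.finrank ℝ W = r := by
    simpa using finrank_span_eq_card hV.linearIndependent
  have : FiniteDimensional ℝ W := FiniteDimensional.span_of_finite ℝ (Set.finite_range _)
  let L' : W →ₗ[ℝ] (Fin m → ℝ) := L.domRestrict W
  -- Rank-nullity: `m` functionals cut at most `m` dimensions off `W`, and an orthonormal basis of
  -- what remains supplies the vectors.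
  have hK := L'.finrank_range_add_finrank_ker
  have hR : Module.finrank ℝ (LinearMap.range L') ≤ m := by
    simpa using Submodule.finrank_le (LinearMap.range L')
  let b := stdOrthonormalBasis ℝ (LinearMap.ker L')
  refine ⟨_, fun i => ((b i : W) : S₁), ?_,
    (b.orthonormal.comp_linearIsometry (LinearMap.ker L').subtypeₗᵢ).comp_linearIsometry
      W.subtypeₗᵢ, fun i => ?_⟩
  · rw [← hW, ← hK, add_comm]
    exact Nat.add_le_add_left hR _
  · set x : S₁ := ((b i : W) : S₁) with hx
    have hx1 : ‖x‖ = 1 := b.orthonormal.1 i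
    have hLx : L x = 0 := (b i).2
    have hYx := hL x hLx
    rw [hx1, mul_one] at hYx
    have hXx : α ≤ ‖X x‖ := by
      obtain ⟨a, ha⟩ := (Submodule.mem_span_range_iff_exists_fun ℝ).1 (b i : W).2
      rw [← hx] at ha
      -- Coefficients extended by zero to `ℕ`, so that Pythagoras applies with respect to both `U`
      -- and `V`.
      let a' : ℕ → ℝ := fun k => if hk : k < r then a ⟨k, hk⟩ else 0
      have ha' : x = ∑ k ∈ Finset.range r, a' k • V k := by
        rw [← ha, Finset.sum_range]
        exact Finset.sum_congr rfl fun k _ => by simp [a']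
      have e0 : ∀ k, σ k = 0 → a' k = 0 := by
        intro k hk
        have : ¬ k < r := fun hkr => hσ ⟨k, hkr⟩ hk
        simp [a', this]
      have e1 : X x = ∑ k ∈ Finset.range r, (a' k * σ k) • U k := by
        rw [ha', map_sum]
        refine Finset.sum_congr rfl fun k hk => ?_
        rw [map_smul, h.apply_right (hσ ⟨k, Finset.mem_range.1 hk⟩), smul_smul]
      refine le_of_sq_le_sq ?_ (norm_nonneg _)
      rw [e1, norm_sq_sum_smul_of_inner_eq_ite h.orthonormal_left _
        fun k hk => by rw [e0 k hk, zero_mul]]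
      have e2 : (1 : ℝ) = ∑ k ∈ Finset.range r, a' k ^ 2 := by
        rw [← norm_sq_sum_smul_of_inner_eq_ite h.orthonormal_right _ e0, ← ha', hx1, one_pow]
      rw [← mul_one (α ^ 2), e2, Finset.mul_sum]
      refine Finset.sum_le_sum fun k hk => ?_
      have := hr k (Finset.mem_range.1 hk)
      rw [mul_pow, mul_comm]
      gcongr
    have := norm_sub_norm_le (X x) (Y x)
    linarith

/-- The images of a maximizing sequence subconverge to some `y` of norm `‖X‖`. Taking `b = y / ‖y‖`,
the vector `X* b` has norm `‖X‖`, and `a` is its normalization. Only the images need to converge,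
not the maximizing sequence. -/
theorem IsCompactOperator.exists_norm_attained [CompleteSpace S₁] [CompleteSpace S₂]
    {X : S₁ →L[ℝ] S₂} (hX : IsCompactOperator X) (h0 : X ≠ 0) :
    ∃ (a : S₁) (b : S₂), ‖a‖ = 1 ∧ ‖b‖ = 1 ∧ X a = ‖X‖ • b ∧
      ContinuousLinearMap.adjoint X b = ‖X‖ • a := by
  have hpos : 0 < ‖X‖ := norm_pos_iff.2 h0
  have hex : ∀ n : ℕ, ∃ x : S₁, ‖x‖ ≤ 1 ∧ ‖X‖ - 1 / ((n : ℝ) + 1) < ‖X x‖ := by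
    intro n
    by_contra! hcon
    rcases le_or_gt 0 (‖X‖ - 1 / ((n : ℝ) + 1)) with hn | hn
    · have := X.opNorm_le_of_unit_norm hn fun x hx => hcon x hx.le
      have : (0 : ℝ) < 1 / ((n : ℝ) + 1) := by positivity
      linarith
    · have := hcon 0 (by simp)
      simp only [map_zero, norm_zero] at this
      linarith
  choose x hx1 hx2 using hex
  obtain ⟨y, -, φ, hφ, hy⟩ := (hX.isCompact_closure_image_closedBall 1).tendsto_subseq
    (x := fun n => X (x n)) fun n => subset_closure ⟨x n, by simpa using hx1 n, rfl⟩
  have hlim : Filter.Tendsto (fun n => ‖X (x (φ n))‖) Filter.atTop (nhds ‖X‖) := by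
    refine tendsto_of_tendsto_of_tendsto_of_le_of_le ?_ tendsto_const_nhds
      (fun n => (hx2 (φ n)).le) fun n => ?_
    · have := (tendsto_one_div_add_atTop_nhds_zero_nat (𝕜 := ℝ)).comp hφ.tendsto_atTop
      simpa using this.const_sub ‖X‖
    · simpa using (X.le_opNorm (x (φ n))).trans
        (mul_le_mul_of_nonneg_left (hx1 _) (norm_nonneg _))
  have hny : ‖y‖ = ‖X‖ := tendsto_nhds_unique hy.norm hlim
  have hy0 : ‖y‖ ≠ 0 := by rw [hny]; exact hpos.ne'
  set b : S₂ := ‖y‖⁻¹ • y with hb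
  have hb1 : ‖b‖ = 1 := by rw [hb, norm_smul, norm_inv, norm_norm, inv_mul_cancel₀ hy0]
  set z := ContinuousLinearMap.adjoint X b with hz
  have hzle : ‖z‖ ≤ ‖X‖ := by
    have := (ContinuousLinearMap.adjoint X).le_opNorm b
    rwa [LinearIsometryEquiv.norm_map, hb1, mul_one] at this
  have hzge : ‖X‖ ≤ ‖z‖ := by
    have h1 : Filter.Tendsto (fun n => inner ℝ b (X (x (φ n)))) Filter.atTop
        (nhds (inner ℝ b y)) := Filter.Tendsto.inner tendsto_const_nhds hy
    have h2 : inner ℝ b y = ‖X‖ := by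
      rw [hb, real_inner_smul_left, real_inner_self_eq_norm_sq, sq, ← mul_assoc,
        inv_mul_cancel₀ hy0, one_mul, hny]
    rw [h2] at h1
    refine le_of_tendsto h1 (Filter.Eventually.of_forall fun n => ?_)
    rw [← ContinuousLinearMap.adjoint_inner_left, ← hz]
    exact (real_inner_le_norm _ _).trans
      (by simpa using mul_le_mul_of_nonneg_left (hx1 (φ n)) (norm_nonneg z))
  have hzX : ‖z‖ = ‖X‖ := le_antisymm hzle hzge
  refine ⟨‖X‖⁻¹ • z, b, ?_, hb1, ?_, ?_⟩
  · rw [norm_smul, norm_inv, norm_norm, hzX, inv_mul_cancel₀ hpos.ne']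
  · set a := ‖X‖⁻¹ • z with ha
    have ha1 : ‖a‖ = 1 := by rw [ha, norm_smul, norm_inv, norm_norm, hzX, inv_mul_cancel₀ hpos.ne']
    have hin : inner ℝ (X a) b = ‖X‖ := by
      rw [← ContinuousLinearMap.adjoint_inner_right, ← hz, ha, real_inner_smul_left,
        real_inner_self_eq_norm_sq, hzX, sq, ← mul_assoc, inv_mul_cancel₀ hpos.ne', one_mul]
    have hXa : ‖X a‖ ≤ ‖X‖ := by simpa [ha1] using X.le_opNorm a
    -- Equality case of Cauchy-Schwarz: the square expands to `‖X a‖² - 2‖X‖² + ‖X‖²`.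
    have : ‖X a - ‖X‖ • b‖ ^ 2 ≤ 0 := by
      rw [norm_sub_sq_real, real_inner_smul_right, hin, norm_smul, hb1, norm_norm]
      nlinarith [norm_nonneg (X a)]
    exact sub_eq_zero.1 (norm_eq_zero.1 (pow_eq_zero_iff two_ne_zero |>.1
      (le_antisymm this (sq_nonneg _))))
  · rw [smul_smul, mul_inv_cancel₀ hpos.ne', one_smul]

/-- The range of `X` is spanned by `r` vectors. -/
def HasRankLE (r : ℕ) (X : S₁ →L[ℝ] S₂) : Prop :=
  ∃ U : Fin r → S₂, ∀ x, X x ∈ Submodule.span ℝ (Set.range U)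

theorem HasRankLE.comp_left {r : ℕ} {X : S₁ →L[ℝ] S₂} (h : HasRankLE r X) (P : S₂ →L[ℝ] S₂) :
    HasRankLE r (P ∘L X) := by
  obtain ⟨U, hU⟩ := h
  refine ⟨fun k => P (U k), fun x => ?_⟩
  have := Submodule.mem_map_of_mem (f := (P : S₂ →ₗ[ℝ] S₂)) (hU x)
  rwa [Submodule.map_span, ← Set.range_comp] at this

theorem HasRankLE.comp_right {r : ℕ} {X : S₁ →L[ℝ] S₂} (h : HasRankLE r X) (Q : S₁ →L[ℝ] S₁) :
    HasRankLE r (X ∘L Q) := by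
  obtain ⟨U, hU⟩ := h
  exact ⟨U, fun x => hU (Q x)⟩

theorem HasRankLE.opRank_le {r : ℕ} {X : S₁ →L[ℝ] S₂} (h : HasRankLE r X) :
    opRank X ≤ r := by
  classical
  obtain ⟨U, hU⟩ := h
  rw [opRank, Cardinal.toENat_le_natCast]
  have h1 : LinearMap.range (X : S₁ →ₗ[ℝ] S₂) ≤
      Submodule.span ℝ ((Finset.univ.image U : Finset S₂) : Set S₂) := by
    rintro _ ⟨x, rfl⟩
    simpa using hU x
  refine (Submodule.rank_mono h1).trans ((rank_span_finset_le _).trans ?_)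
  exact_mod_cast Finset.card_image_le.trans (by simp)

end SingularValueDecomposition

/-! ### Matricizations: rank-one tensors, Bessel's inequality, compactness -/

section Matricization

open InnerProductSpace

variable {d : ℕ} {H : Fin d → Type*} [∀ j, NormedAddCommGroup (H j)]
    [∀ j, InnerProductSpace ℝ (H j)] [∀ j, CompleteSpace (H j)]

theorem matricization_apply (n : Finset (Fin d)) (u : HilbertTensor H)
    (a : HilbertTensor (fun j : {j // j ∉ n} => H j)) (k : ∀ j : {j // j ∈ n}, onbIndex (H j)) :
    matricization n u a k = inner ℝ (matRow n u k) a := rfl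

theorem norm_matricization_le (n : Finset (Fin d)) (u : HilbertTensor H) :
    ‖matricization n u‖ ≤ ‖u‖ :=
  LinearMap.mkContinuous_norm_le _ (norm_nonneg _) _

/-- The matricization as a continuous linear map. -/
def matricizationL (n : Finset (Fin d)) : HilbertTensor H →L[ℝ]
    (HilbertTensor (fun j : {j // j ∉ n} => H j) →L[ℝ]
      HilbertTensor (fun j : {j // j ∈ n} => H j)) :=
  LinearMap.mkContinuous
    { toFun := matricization n
      map_add' := fun u v => by
        ext a k
        exact inner_add_left (matRow n u k) (matRow n v k) a
      map_smul' := fun c u => by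
        ext a k
        exact real_inner_smul_left (matRow n u k) a c }
    1 fun u => by simpa using norm_matricization_le n u

theorem matricizationL_apply (n : Finset (Fin d)) (u : HilbertTensor H) :
    matricizationL n u = matricization n u := rfl

/-- The tensor with matricization `⟨a, ·⟩ b`. -/
def pairTensor (n : Finset (Fin d)) (b : HilbertTensor (fun j : {j // j ∈ n} => H j))
    (a : HilbertTensor (fun j : {j // j ∉ n} => H j)) : HilbertTensor H :=
  ⟨fun q => b ((mergeIndex n).symm q).1 * a ((mergeIndex n).symm q).2, by
    refine memlp_two_iff_summable_sq.2 ((mergeIndex n).summable_iff.1 ?_)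
    refine ((memlp_two_iff_summable_sq.1 (lp.memℓp b)).mul_of_nonneg
      (memlp_two_iff_summable_sq.1 (lp.memℓp a)) (fun _ => sq_nonneg _)
      fun _ => sq_nonneg _).congr fun q => ?_
    simp [mul_pow]⟩

theorem pairTensor_merge (n : Finset (Fin d)) (b : HilbertTensor (fun j : {j // j ∈ n} => H j))
    (a : HilbertTensor (fun j : {j // j ∉ n} => H j)) (k : ∀ j : {j // j ∈ n}, onbIndex (H j))
    (l : ∀ j : {j // j ∉ n}, onbIndex (H j)) :
    pairTensor n b a (mergeIndex n (k, l)) = b k * a l := by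
  simp [pairTensor]

theorem matricization_pairTensor (n : Finset (Fin d))
    (b : HilbertTensor (fun j : {j // j ∈ n} => H j))
    (a : HilbertTensor (fun j : {j // j ∉ n} => H j)) :
    matricization n (pairTensor n b a) = rankOne ℝ b a := by
  ext x k
  have h : matRow n (pairTensor n b a) k = b k • a := by
    ext l
    exact pairTensor_merge n b a k l
  rw [matricization_apply, h, real_inner_smul_left, rankOne_apply, mul_comm]
  rfl

/-- Fubini for the coefficient sums. It lets the tensor inner product play the role of the
Hilbert-Schmidt inner product of operators. -/
theorem inner_pairTensor (n : Finset (Fin d)) (b : HilbertTensor (fun j : {j // j ∈ n} => H j))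
    (a : HilbertTensor (fun j : {j // j ∉ n} => H j)) (u : HilbertTensor H) :
    inner ℝ (pairTensor n b a) u = inner ℝ b (matricization n u a) := by
  have h := lp.hasSum_inner (𝕜 := ℝ) (pairTensor n b a) u
  rw [← (mergeIndex n).hasSum_iff] at h
  have h1 : ∀ k, HasSum (fun l => inner ℝ (pairTensor n b a (mergeIndex n (k, l)))
      (u (mergeIndex n (k, l)))) (inner ℝ (b k) (matricization n u a k)) := by
    intro k
    have h2 := (lp.hasSum_inner (𝕜 := ℝ) (matRow n u k) a).mul_right (b k)
    refine Eq.subst (motive := fun f => HasSum f _) (funext fun l => ?_) h2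
    rw [pairTensor_merge]
    change a l * u (mergeIndex n (k, l)) * b k = u (mergeIndex n (k, l)) * (b k * a l)
    ring
  exact (h.prod_fiberwise h1).unique (lp.hasSum_inner (𝕜 := ℝ) b (matricization n u a))

theorem inner_pairTensor_pairTensor (n : Finset (Fin d))
    (b b' : HilbertTensor (fun j : {j // j ∈ n} => H j))
    (a a' : HilbertTensor (fun j : {j // j ∉ n} => H j)) :
    inner ℝ (pairTensor n b a) (pairTensor n b' a') = inner ℝ b b' * inner ℝ a' a := by
  rw [inner_pairTensor, matricization_pairTensor, rankOne_apply, real_inner_smul_right, mul_comm]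

theorem norm_pairTensor (n : Finset (Fin d)) (b : HilbertTensor (fun j : {j // j ∈ n} => H j))
    (a : HilbertTensor (fun j : {j // j ∉ n} => H j)) : ‖pairTensor n b a‖ = ‖b‖ * ‖a‖ := by
  have h := inner_pairTensor_pairTensor n b b a a
  rw [real_inner_self_eq_norm_sq, real_inner_self_eq_norm_sq, real_inner_self_eq_norm_sq,
    ← mul_pow] at h
  exact (sq_eq_sq₀ (norm_nonneg _) (by positivity)).1 h

/-- Bessel's inequality for the Hilbert-Schmidt norm. -/
theorem sum_norm_sq_matricization_le (n : Finset (Fin d)) (u : HilbertTensor H) {ι : Type*}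
    [Fintype ι] {x : ι → HilbertTensor (fun j : {j // j ∉ n} => H j)} (hx : Orthonormal ℝ x) :
    ∑ i, ‖matricization n u (x i)‖ ^ 2 ≤ ‖u‖ ^ 2 := by
  have h : ∀ i ∈ Finset.univ, HasSum (fun k => matricization n u (x i) k ^ 2)
      (‖matricization n u (x i)‖ ^ 2) := fun i _ => by
    simpa using lp.hasSum_norm (p := 2) (by norm_num) (matricization n u (x i))
  -- Bessel is applied to each row separately and summed over the rows.
  refine hasSum_le (fun k => ?_) (hasSum_sum h) (hasSum_norm_matRow_sq n u)
  simp_rw [matricization_apply]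
  have := hx.sum_inner_products_le (matRow n u k) (s := Finset.univ)
  simpa [real_inner_comm] using this

/-- Tensors with compact matricization form a closed subspace containing every `pairTensor`. A
tensor orthogonal to all of these has zero matricization, hence vanishes. -/
theorem isCompactOperator_matricization (n : Finset (Fin d)) (u : HilbertTensor H) :
    IsCompactOperator (matricization n u) := by
  let K : Submodule ℝ (HilbertTensor H) :=
    (compactOperator (RingHom.id ℝ) (HilbertTensor (fun j : {j // j ∉ n} => H j))
      (HilbertTensor (fun j : {j // j ∈ n} => H j))).comap (matricizationL n).toLinearMap
  have hK : IsClosed (K : Set (HilbertTensor H)) :=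
    isClosed_setOfPred_isCompactOperator.preimage (matricizationL n).continuous
  have hp : ∀ b a, pairTensor n b a ∈ K := by
    intro b a
    change IsCompactOperator (matricization n (pairTensor n b a))
    rw [matricization_pairTensor, rankOne_def']
    have h1 : IsCompactOperator (innerSL ℝ a) :=
      isCompactOperator_of_locallyCompactSpace_dom (innerSL ℝ a)
    exact h1.clm_comp (ContinuousLinearMap.toSpanSingleton ℝ b)
  have htop : K = ⊤ := by
    have : CompleteSpace K := hK.completeSpace_coe
    rw [← Submodule.orthogonal_eq_bot_iff, eq_bot_iff]
    intro v hv
    have h0 : matricization n v = 0 := by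
      ext1 a
      refine ext_inner_left ℝ fun b => ?_
      rw [← inner_pairTensor, (Submodule.mem_orthogonal K v).1 hv _ (hp b a)]
      simp
    rw [Submodule.mem_bot]
    refine matricization_injective n (h0.trans ?_)
    exact ((matricizationL n).map_zero).symm
  have : u ∈ K := htop ▸ Submodule.mem_top
  exact this

end Matricization

/-! ### Deflation, thresholding residuals and contractions attached to an SVD -/

section SVDGeneral

open InnerProductSpace

variable {S₁ S₂ : Type*} [NormedAddCommGroup S₁] [InnerProductSpace ℝ S₁]
    [NormedAddCommGroup S₂] [InnerProductSpace ℝ S₂]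

theorem orthonormal_subtype_of_lt {S : Type*} [NormedAddCommGroup S] [InnerProductSpace ℝ S]
    {σ : ℕ → ℝ} {V : ℕ → S} (h1 : ∀ k, σ k ≠ 0 → ‖V k‖ = 1)
    (h0 : ∀ j k, j < k → σ j ≠ 0 → σ k ≠ 0 → inner ℝ (V k) (V j) = 0) :
    Orthonormal ℝ fun k : {k // σ k ≠ 0} => V k := by
  refine ⟨fun k => h1 k k.2, ?_⟩
  rintro ⟨j, hj⟩ ⟨k, hk⟩ hjk
  change inner ℝ (V j) (V k) = 0
  rcases lt_or_gt_of_ne (fun e => hjk (Subtype.ext e) : j ≠ k) with h | h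
  · rw [real_inner_comm]
    exact h0 j k h hj hk
  · exact h0 k j h hk hj

/-- Repeatedly removing the leading singular term gives nonincreasing norms and orthonormal
singular vectors. -/
theorem antitone_orthonormal_of_deflation [CompleteSpace S₁] [CompleteSpace S₂]
    {X : ℕ → S₁ →L[ℝ] S₂} {σ : ℕ → ℝ} {U : ℕ → S₂} {V : ℕ → S₁} (hσ : ∀ k, σ k = ‖X k‖)
    (hX : ∀ k, X (k + 1) = X k - σ k • rankOne ℝ (U k) (V k))
    (hV1 : ∀ k, σ k ≠ 0 → ‖V k‖ = 1) (hU1 : ∀ k, σ k ≠ 0 → ‖U k‖ = 1)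
    (hXV : ∀ k, σ k ≠ 0 → X k (V k) = σ k • U k)
    (hXU : ∀ k, σ k ≠ 0 → ContinuousLinearMap.adjoint (X k) (U k) = σ k • V k) :
    Antitone σ ∧ (Orthonormal ℝ fun k : {k // σ k ≠ 0} => U k) ∧
      Orthonormal ℝ fun k : {k // σ k ≠ 0} => V k := by
  have hXa : ∀ k x, X (k + 1) x = X k x - (σ k * inner ℝ (V k) x) • U k := by
    intro k x
    rw [hX, sub_apply, smul_apply, rankOne_apply, smul_smul]
  have hXb : ∀ k y, ContinuousLinearMap.adjoint (X (k + 1)) y =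
      ContinuousLinearMap.adjoint (X k) y - (σ k * inner ℝ (U k) y) • V k := by
    intro k y
    rw [hX, map_sub, map_smulₛₗ, adjoint_rankOne, sub_apply, smul_apply, rankOne_apply, smul_smul]
    rfl
  have hσ0 : ∀ k, 0 ≤ σ k := fun k => hσ k ▸ norm_nonneg _
  have hanti : Antitone σ := by
    refine antitone_nat_of_succ_le fun k => ?_
    by_cases h0 : σ k = 0
    · rw [hσ, hX, h0, zero_smul, sub_zero, ← hσ, h0]
    rw [hσ (k + 1)]
    refine ContinuousLinearMap.opNorm_le_bound _ (hσ0 k) fun x => ?_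
    -- Deflating is precomposing with the projection onto the orthogonal complement of `V k`, so the
    -- norm cannot grow.
    have e : X (k + 1) x = X k (x - inner ℝ (V k) x • V k) := by
      rw [hXa, map_sub, map_smul, hXV k h0, smul_smul, mul_comm]
    rw [e, hσ k]
    refine (ContinuousLinearMap.le_opNorm _ _).trans
      (mul_le_mul_of_nonneg_left ?_ (norm_nonneg _))
    refine le_of_sq_le_sq ?_ (norm_nonneg x)
    rw [norm_sub_sq_real, real_inner_smul_right, norm_smul, hV1 k h0, mul_one, Real.norm_eq_abs,
      sq_abs, real_inner_comm (V k) x]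
    nlinarith [sq_nonneg (inner ℝ (V k) x)]
  have hstep : ∀ j k, X k (V j) = 0 → ContinuousLinearMap.adjoint (X k) (U j) = 0 →
      σ k * inner ℝ (V k) (V j) = 0 ∧ σ k * inner ℝ (U k) (U j) = 0 := by
    intro j k h1 h2
    by_cases h0 : σ k = 0
    · simp [h0]
    constructor
    · rw [← real_inner_smul_left, ← hXU _ h0, ContinuousLinearMap.adjoint_inner_left, h1,
        inner_zero_right]
    · rw [← real_inner_smul_left, ← hXV _ h0, ← ContinuousLinearMap.adjoint_inner_right, h2,
        inner_zero_right]
  -- Once removed, `V j` and `U j` stay in the kernels of all later operators and of their adjoints;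
  -- by `hstep` this makes them orthogonal to the later singular vectors.
  have hker : ∀ j k, j < k → σ j ≠ 0 → X k (V j) = 0 ∧
      ContinuousLinearMap.adjoint (X k) (U j) = 0 := by
    intro j k hjk hj
    induction k, hjk using Nat.le_induction with
    | base =>
      constructor
      · rw [hXa, hXV j hj, real_inner_self_eq_norm_sq, hV1 j hj]; simp
      · rw [hXb, hXU j hj, real_inner_self_eq_norm_sq, hU1 j hj]; simp
    | succ k _ ih =>
      have h := hstep j k ih.1 ih.2
      constructor
      · rw [hXa, ih.1, h.1, zero_smul, sub_zero]
      · rw [hXb, ih.2, h.2, zero_smul, sub_zero]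
  refine ⟨hanti, orthonormal_subtype_of_lt hU1 fun j k hjk hj hk => ?_,
    orthonormal_subtype_of_lt hV1 fun j k hjk hj hk => ?_⟩
  · exact (mul_eq_zero.1 (hstep j k (hker j k hjk hj).1 (hker j k hjk hj).2).2).resolve_left hk
  · exact (mul_eq_zero.1 (hstep j k (hker j k hjk hj).1 (hker j k hjk hj).2).1).resolve_left hk

theorem summable_smul_of_orthonormal_subtype {S : Type*} [NormedAddCommGroup S]
    [InnerProductSpace ℝ S] [CompleteSpace S] {σ : ℕ → ℝ} {x : ℕ → S}
    (hx : Orthonormal ℝ fun k : {k // σ k ≠ 0} => x k) (hσ : Summable fun k => σ k ^ 2) :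
    Summable fun k => σ k • x k := by
  have h1 : Summable fun k : {k // σ k ≠ 0} => σ k • x k := by
    have := (hx.orthogonalFamily.summable_iff_norm_sq_summable fun k => σ k).2
      ((hσ.subtype {k | σ k ≠ 0}).congr fun k => by simp)
    simpa using this
  refine (Function.Injective.summable_iff (Subtype.val_injective (p := fun k => σ k ≠ 0))
    fun k hk => ?_).1 h1
  have : σ k = 0 := by simpa using hk
  rw [this, zero_smul]

variable {X : S₁ →L[ℝ] S₂} {σ : ℕ → ℝ} {U : ℕ → S₂} {V : ℕ → S₁}

/-- The residual has the same singular vectors, with singular values `min (σ k) α`. -/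
theorem IsSVD.norm_sub_sum_le (hS : IsSVD X σ U V) {α : ℝ} (hα : 0 < α) {r : ℕ}
    (hr : ∀ k, α < σ k ↔ k < r) :
    ‖X - ∑ k ∈ Finset.range r, (σ k - α) • rankOne ℝ (U k) (V k)‖ ≤ α := by
  have h1 : HasSum (fun k => (if k < r then σ k - α else 0) • rankOne ℝ (U k) (V k))
      (∑ k ∈ Finset.range r, (if k < r then σ k - α else 0) • rankOne ℝ (U k) (V k)) :=
    hasSum_sum_of_ne_finset_zero fun k hk => by
      rw [if_neg (by simpa using hk), zero_smul]
  have h3 : ∑ k ∈ Finset.range r, (σ k - α) • rankOne ℝ (U k) (V k) =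
      ∑ k ∈ Finset.range r, (if k < r then σ k - α else 0) • rankOne ℝ (U k) (V k) :=
    Finset.sum_congr rfl fun k hk => by rw [if_pos (Finset.mem_range.1 hk)]
  have h2 := hS.hasSum.sub h1
  rw [← h3] at h2
  simp only [← sub_smul] at h2
  refine ContinuousLinearMap.opNorm_le_bound _ hα.le fun x => ?_
  refine norm_hasSum_rankOne_le hS.orthonormal_left hS.orthonormal_right hα.le h2
    (fun k hk => ?_) fun k => Or.inl ?_
  · have : ¬ k < r := fun hkr => (hα.trans ((hr k).2 hkr)).ne' hk
    simp [hk, this]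
  · split_ifs with hk
    · rw [sub_sub_cancel, abs_of_pos hα]
    · rw [sub_zero, abs_of_nonneg (hS.nonneg k)]
      exact not_lt.1 fun h => hk ((hr k).1 h)

/-- Thresholding multiplies `σ k` by `(σ k - α) / σ k`, which lies in `[0, 1]` for `k < r`. The
diagonal operators with these entries, in `U` and in `V`, are `P` and `Q`. -/
theorem IsSVD.exists_contractions (hS : IsSVD X σ U V) {α : ℝ} (hα : 0 < α) {r : ℕ}
    (hr : ∀ k, α < σ k ↔ k < r) :
    (∃ P : S₂ →L[ℝ] S₂, ‖P‖ ≤ 1 ∧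
      ∑ k ∈ Finset.range r, (σ k - α) • rankOne ℝ (U k) (V k) = P ∘L X) ∧
    ∃ Q : S₁ →L[ℝ] S₁, ‖Q‖ ≤ 1 ∧
      ∑ k ∈ Finset.range r, (σ k - α) • rankOne ℝ (U k) (V k) = X ∘L Q := by
  have hσ : ∀ k ∈ Finset.range r, σ k ≠ 0 := fun k hk =>
    (hα.trans ((hr k).2 (Finset.mem_range.1 hk))).ne'
  let c : ℕ → ℝ := fun k => if k < r then (σ k - α) / σ k else 0
  have hc0 : ∀ k, σ k = 0 → c k = 0 := fun k hk =>
    if_neg fun hkr => hσ k (Finset.mem_range.2 hkr) hk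
  have hc1 : ∀ k, |c k| ≤ 1 := by
    intro k
    simp only [c]
    split_ifs with hk
    · have h1 := (hr k).2 hk
      have h2 : 0 < σ k := hα.trans h1
      rw [abs_of_nonneg (div_nonneg (by linarith) h2.le), div_le_one h2]
      linarith
    · simp
  have hcσ : ∀ k ∈ Finset.range r, c k * σ k = σ k - α := by
    intro k hk
    change (if k < r then (σ k - α) / σ k else 0) * σ k = σ k - α
    rw [if_pos (Finset.mem_range.1 hk), div_mul_cancel₀ _ (hσ k hk)]
  constructor
  · refine ⟨∑ k ∈ Finset.range r, c k • rankOne ℝ (U k) (U k), ?_, ?_⟩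
    · refine ContinuousLinearMap.opNorm_le_bound _ zero_le_one fun x => ?_
      refine le_of_sq_le_sq ?_ (by positivity)
      rw [sum_apply, mul_pow]
      exact norm_sq_sum_rankOne_le hS.orthonormal_left hS.orthonormal_left hc0
        (fun k => Or.inl (hc1 k)) _
    · ext1 x
      rw [ContinuousLinearMap.comp_apply, sum_apply, sum_apply]
      refine Finset.sum_congr rfl fun k hk => ?_
      rw [smul_apply, rankOne_apply, smul_apply, rankOne_apply, hS.inner_left_apply (hσ k hk),
        smul_smul, smul_smul, ← mul_assoc, hcσ k hk]
  · refine ⟨∑ k ∈ Finset.range r, c k • rankOne ℝ (V k) (V k), ?_, ?_⟩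
    · refine ContinuousLinearMap.opNorm_le_bound _ zero_le_one fun x => ?_
      refine le_of_sq_le_sq ?_ (by positivity)
      rw [sum_apply, mul_pow]
      exact norm_sq_sum_rankOne_le hS.orthonormal_right hS.orthonormal_right hc0
        (fun k => Or.inl (hc1 k)) _
    · ext1 x
      rw [ContinuousLinearMap.comp_apply, sum_apply, sum_apply, map_sum]
      refine Finset.sum_congr rfl fun k hk => ?_
      rw [smul_apply, rankOne_apply, smul_apply, rankOne_apply, map_smul, map_smul,
        hS.apply_right (hσ k hk), smul_smul, smul_smul, smul_smul, ← hcσ k hk]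
      congr 1
      ring

end SVDGeneral

/-! ### Existence of singular value decompositions of matricizations -/

section SVDExistence

open InnerProductSpace

variable {d : ℕ} {H : Fin d → Type*} [∀ j, NormedAddCommGroup (H j)]
    [∀ j, InnerProductSpace ℝ (H j)] [∀ j, CompleteSpace (H j)]

theorem orthonormal_pairTensor (n : Finset (Fin d)) {σ : ℕ → ℝ}
    {U : ℕ → HilbertTensor (fun j : {j // j ∈ n} => H j)}
    {V : ℕ → HilbertTensor (fun j : {j // j ∉ n} => H j)}
    (hU : Orthonormal ℝ fun k : {k // σ k ≠ 0} => U k)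
    (hV : Orthonormal ℝ fun k : {k // σ k ≠ 0} => V k) :
    Orthonormal ℝ fun k : {k // σ k ≠ 0} => pairTensor n (U k) (V k) := by
  refine ⟨fun k => ?_, fun j k hjk => ?_⟩
  · rw [norm_pairTensor, hU.1 k, hV.1 k, one_mul]
  · have : inner ℝ (U j) (U k) = 0 := hU.2 hjk
    change inner ℝ (pairTensor n (U j) (V j)) (pairTensor n (U k) (V k)) = 0
    rw [inner_pairTensor_pairTensor, this, zero_mul]

/-- The hypothesis sits inside the existential so that a pair can be chosen for every tensor; when
the matricization vanishes, deflation subtracts zero. -/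
theorem exists_leading_singular_vectors (n : Finset (Fin d)) (u : HilbertTensor H) :
    ∃ x : HilbertTensor (fun j : {j // j ∉ n} => H j) ×
        HilbertTensor (fun j : {j // j ∈ n} => H j), ‖matricization n u‖ ≠ 0 →
      ‖x.1‖ = 1 ∧ ‖x.2‖ = 1 ∧ matricization n u x.1 = ‖matricization n u‖ • x.2 ∧
        ContinuousLinearMap.adjoint (matricization n u) x.2 = ‖matricization n u‖ • x.1 := by
  by_cases h : ‖matricization n u‖ = 0
  · exact ⟨0, fun h' => absurd h h'⟩
  · obtain ⟨a, b, hab⟩ := (isCompactOperator_matricization n u).exists_norm_attained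
      (norm_ne_zero_iff.1 h)
    exact ⟨(a, b), fun _ => hab⟩

/-- Remove the leading term of the singular value decomposition. -/
def deflate (n : Finset (Fin d)) (u : HilbertTensor H) : HilbertTensor H :=
  u - ‖matricization n u‖ • pairTensor n (exists_leading_singular_vectors n u).choose.2
    (exists_leading_singular_vectors n u).choose.1

theorem exists_deflation (n : Finset (Fin d)) (u : HilbertTensor H) :
    ∃ (w : ℕ → HilbertTensor H) (U : ℕ → HilbertTensor (fun j : {j // j ∈ n} => H j))
      (V : ℕ → HilbertTensor (fun j : {j // j ∉ n} => H j)), w 0 = u ∧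
      (∀ k, w (k + 1) = w k - ‖matricization n (w k)‖ • pairTensor n (U k) (V k)) ∧
      ∀ k, ‖matricization n (w k)‖ ≠ 0 → ‖V k‖ = 1 ∧ ‖U k‖ = 1 ∧
        matricization n (w k) (V k) = ‖matricization n (w k)‖ • U k ∧
        ContinuousLinearMap.adjoint (matricization n (w k)) (U k) =
          ‖matricization n (w k)‖ • V k :=
  ⟨fun k => (deflate n)^[k] u,
    fun k => (exists_leading_singular_vectors n ((deflate n)^[k] u)).choose.2,
    fun k => (exists_leading_singular_vectors n ((deflate n)^[k] u)).choose.1, rfl,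
    fun k => Function.iterate_succ_apply' (deflate n) k u,
    fun k => (exists_leading_singular_vectors n ((deflate n)^[k] u)).choose_spec⟩

/-- The matricization of a tensor, a Hilbert-Schmidt operator, has a singular value
decomposition. -/
theorem exists_isSVD (n : Finset (Fin d)) (u : HilbertTensor H) :
    ∃ σ U V, IsSVD (matricization n u) σ U V := by
  obtain ⟨w, U, V, hw0, hw, hspec⟩ := exists_deflation n u
  obtain ⟨X, hXw⟩ : ∃ X, X = fun k => matricization n (w k) := ⟨_, rfl⟩
  replace hXw : ∀ k, X k = matricization n (w k) := congrFun hXw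
  obtain ⟨σ, hσ⟩ : ∃ σ : ℕ → ℝ, σ = fun k => ‖X k‖ := ⟨_, rfl⟩
  replace hσ : ∀ k, σ k = ‖X k‖ := congrFun hσ
  simp only [← hXw, ← hσ] at hw hspec
  have hV1 : ∀ k, σ k ≠ 0 → ‖V k‖ = 1 := fun k hk => (hspec k hk).1
  have hU1 : ∀ k, σ k ≠ 0 → ‖U k‖ = 1 := fun k hk => (hspec k hk).2.1
  have hXV : ∀ k, σ k ≠ 0 → X k (V k) = σ k • U k := fun k hk => (hspec k hk).2.2.1
  have hXU : ∀ k, σ k ≠ 0 → ContinuousLinearMap.adjoint (X k) (U k) = σ k • V k :=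
    fun k hk => (hspec k hk).2.2.2
  have hX : ∀ k, X (k + 1) = X k - σ k • rankOne ℝ (U k) (V k) := by
    intro k
    rw [hXw, hXw, ← matricization_pairTensor, ← matricizationL_apply, hw, map_sub, map_smul]
    rfl
  obtain ⟨hanti, hUon, hVon⟩ := antitone_orthonormal_of_deflation hσ hX hV1 hU1 hXV hXU
  have hσ0 : ∀ k, 0 ≤ σ k := fun k => hσ k ▸ norm_nonneg _
  have hp := orthonormal_pairTensor n hUon hVon
  -- Each deflation removes exactly `σ k ^ 2` from the squared norm, so the singular values are
  -- square summable.
  have hnorm : ∀ k, ‖w k‖ ^ 2 = ‖u‖ ^ 2 - ∑ j ∈ Finset.range k, σ j ^ 2 := by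
    intro k
    induction k with
    | zero => simp [hw0]
    | succ k ih =>
      rw [Finset.sum_range_succ, ← sub_sub, ← ih, hw]
      by_cases h0 : σ k = 0
      · simp [h0]
      have e : inner ℝ (w k) (pairTensor n (U k) (V k)) = σ k := by
        rw [real_inner_comm, inner_pairTensor]
        rw [← hXw, hXV k h0, real_inner_smul_right, real_inner_self_eq_norm_sq, hU1 k h0]
        simp
      rw [norm_sub_sq_real, real_inner_smul_right, e, norm_smul, norm_pairTensor, hU1 k h0,
        hV1 k h0, Real.norm_eq_abs, mul_one, mul_one, sq_abs]
      ring
  have hσs : Summable fun k => σ k ^ 2 :=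
    summable_of_sum_range_le (c := ‖u‖ ^ 2) (fun _ => sq_nonneg _) fun k => by
      have := hnorm k
      nlinarith [sq_nonneg ‖w k‖]
  -- Unconditional convergence comes from the tensor space, where the terms are orthogonal; the
  -- value of the sum is then read off from the partial sums, since `‖X k‖ = σ k → 0`.
  have hps : Summable fun k => σ k • pairTensor n (U k) (V k) :=
    summable_smul_of_orthonormal_subtype hp hσs
  refine ⟨σ, U, V, hanti, hσ0, hUon, hVon, ?_⟩
  have h1 := hps.hasSum.mapL (matricizationL n)
  simp only [map_smul, matricizationL_apply, matricization_pairTensor] at h1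
  have hXk : ∀ k, ∑ j ∈ Finset.range k, σ j • rankOne ℝ (U j) (V j) =
      matricization n u - X k := by
    intro k
    induction k with
    | zero => simp [hXw, hw0]
    | succ k ih => rw [Finset.sum_range_succ, ih, hX]; abel
  have h2 : Filter.Tendsto (fun k => ∑ j ∈ Finset.range k, σ j • rankOne ℝ (U j) (V j))
      Filter.atTop (nhds (matricization n u)) := by
    simp_rw [hXk]
    have h3 : Filter.Tendsto X Filter.atTop (nhds 0) := by
      refine tendsto_zero_iff_norm_tendsto_zero.2 ?_
      have h4 := (hσs.tendsto_atTop_zero).sqrt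
      simp only [Real.sqrt_sq (hσ0 _), Real.sqrt_zero] at h4
      exact h4.congr hσ
    simpa using h3.const_sub (matricization n u)
  rwa [tendsto_nhds_unique h2 h1.tendsto_sum_nat]

end SVDExistence

/-! ### Soft thresholding at one edge: finite form, nonexpansiveness, rank -/

section SoftThresholding

open InnerProductSpace

variable {d : ℕ} {H : Fin d → Type*} [∀ j, NormedAddCommGroup (H j)]
    [∀ j, InnerProductSpace ℝ (H j)] [∀ j, CompleteSpace (H j)]

theorem isSVD_singularValues (n : Finset (Fin d)) (u : HilbertTensor H) :
    ∃ U V, IsSVD (matricization n u) (tensorSingularValues n u) U V := by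
  have h := exists_isSVD n u
  rw [tensorSingularValues, singularValues, dif_pos h]
  exact h.choose_spec

theorem softThreshold_of_nonneg {α x : ℝ} (hα : 0 < α) (hx : 0 ≤ x) :
    softThreshold α x = max (x - α) 0 := by
  rcases hx.eq_or_lt with rfl | hx
  · simp [softThreshold, hα.le]
  · rw [softThreshold, Real.sign_of_pos hx, one_mul, abs_of_pos hx]

/-- Only finitely many singular values exceed `α`, so the series defining the thresholded operator
is a finite sum of matricized rank-one tensors. It lies in the range of the matricization, where
`Function.invFun` is a true inverse. -/
theorem exists_tensorSoftThreshold_eq (n : Finset (Fin d)) {α : ℝ} (hα : 0 < α)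
    (u : HilbertTensor H) : ∃ σ U V r, IsSVD (matricization n u) σ U V ∧
      (∀ k, α < σ k ↔ k < r) ∧ tensorSoftThreshold n α u =
        ∑ k ∈ Finset.range r, (σ k - α) • pairTensor n (U k) (V k) := by
  have h : ∃ D : (ℕ → ℝ) × (ℕ → HilbertTensor (fun j : {j // j ∈ n} => H j)) ×
      (ℕ → HilbertTensor (fun j : {j // j ∉ n} => H j)),
      IsSVD (matricization n u) D.1 D.2.1 D.2.2 := by
    obtain ⟨σ, U, V, h⟩ := exists_isSVD n u
    exact ⟨(σ, U, V), h⟩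
  have hS := h.choose_spec
  obtain ⟨r, hr⟩ := hS.exists_lt_iff hα
  refine ⟨_, _, _, r, hS, hr, ?_⟩
  have e : softThresholdOp α (matricization n u) = matricization n
      (∑ k ∈ Finset.range r, (h.choose.1 k - α) •
        pairTensor n (h.choose.2.1 k) (h.choose.2.2 k)) := by
    rw [softThresholdOp, dif_pos h, tsum_eq_sum (s := Finset.range r)]
    · simp only [← matricizationL_apply, map_sum, map_smul]
      simp only [matricizationL_apply, matricization_pairTensor]
      refine Finset.sum_congr rfl fun k hk => ?_
      have := (hr k).2 (Finset.mem_range.1 hk)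
      rw [softThreshold_of_nonneg hα (hS.nonneg k), max_eq_left (by linarith)]
    · intro k hk
      have := not_lt.1 (fun hlt => hk (Finset.mem_range.2 ((hr k).1 hlt)))
      rw [softThreshold_of_nonneg hα (hS.nonneg k), max_eq_right (by linarith), zero_smul]
  rw [tensorSoftThreshold, e]
  exact Function.leftInverse_invFun (matricization_injective n) _

theorem exists_matricization_tensorSoftThreshold (n : Finset (Fin d)) {α : ℝ} (hα : 0 < α)
    (u : HilbertTensor H) : ∃ σ U V r, IsSVD (matricization n u) σ U V ∧
      (∀ k, α < σ k ↔ k < r) ∧ matricization n (tensorSoftThreshold n α u) =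
        ∑ k ∈ Finset.range r, (σ k - α) • rankOne ℝ (U k) (V k) := by
  obtain ⟨σ, U, V, r, hS, hr, e⟩ := exists_tensorSoftThreshold_eq n hα u
  refine ⟨σ, U, V, r, hS, hr, ?_⟩
  rw [e]
  simp only [← matricizationL_apply, map_sum, map_smul]
  simp only [matricizationL_apply, matricization_pairTensor]

/-- The variational inequality that characterises soft thresholding as the proximal map of the
nuclear norm. -/
theorem tensorSoftThreshold_variational (n : Finset (Fin d)) {α : ℝ} (hα : 0 < α)
    (u : HilbertTensor H) : ‖matricization n (u - tensorSoftThreshold n α u)‖ ≤ α ∧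
      ∀ z : HilbertTensor H, ‖matricization n z‖ ≤ α →
        inner ℝ (tensorSoftThreshold n α u) z ≤
          inner ℝ (tensorSoftThreshold n α u) (u - tensorSoftThreshold n α u) := by
  obtain ⟨σ, U, V, r, hS, hr, e⟩ := exists_tensorSoftThreshold_eq n hα u
  have hσ : ∀ k ∈ Finset.range r, σ k ≠ 0 := fun k hk =>
    (hα.trans ((hr k).2 (Finset.mem_range.1 hk))).ne'
  have hlt : ∀ k ∈ Finset.range r, 0 ≤ σ k - α := fun k hk =>
    sub_nonneg.2 ((hr k).2 (Finset.mem_range.1 hk)).le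
  constructor
  · have h1 := hS.norm_sub_sum_le hα hr
    simp only [← matricization_pairTensor, ← matricizationL_apply, ← map_smul, ← map_sum,
      ← map_sub] at h1
    rwa [← e, matricizationL_apply] at h1
  · intro z hz
    -- Duality of nuclear and operator norm: each pairing `⟨U k, M z (V k)⟩` is at most `α`. The
    -- residual of `u` attains the bound, as `(σ - α) σ - (σ - α)² = (σ - α) α`.
    have h1 : inner ℝ (tensorSoftThreshold n α u) z ≤
        ∑ k ∈ Finset.range r, (σ k - α) * α := by
      rw [e, sum_inner]
      refine Finset.sum_le_sum fun k hk => ?_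
      rw [real_inner_smul_left, inner_pairTensor]
      refine mul_le_mul_of_nonneg_left ?_ (hlt k hk)
      refine (real_inner_le_norm _ _).trans ?_
      rw [hS.norm_left (hσ k hk), one_mul]
      refine ((matricization n z).le_of_opNorm_le hz _).trans ?_
      rw [hS.norm_right (hσ k hk), mul_one]
    refine h1.trans (le_of_eq ?_)
    have h2 : inner ℝ (tensorSoftThreshold n α u) u =
        ∑ k ∈ Finset.range r, (σ k - α) * σ k := by
      rw [e, sum_inner]
      refine Finset.sum_congr rfl fun k hk => ?_
      rw [real_inner_smul_left, inner_pairTensor, hS.apply_right (hσ k hk), real_inner_smul_right,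
        real_inner_self_eq_norm_sq, hS.norm_left (hσ k hk), one_pow, mul_one]
    have h3 : ‖tensorSoftThreshold n α u‖ ^ 2 = ∑ k ∈ Finset.range r, (σ k - α) ^ 2 := by
      have hd : ∀ k, σ k = 0 → (if k < r then σ k - α else 0) = 0 := fun k hk =>
        if_neg fun hkr => hσ k (Finset.mem_range.2 hkr) hk
      have := norm_sq_sum_smul_of_inner_eq_ite (U := fun k => pairTensor n (U k) (V k))
        (orthonormal_pairTensor n hS.orthonormal_left hS.orthonormal_right) (Finset.range r) hd
      rw [e]
      convert this using 1
      · congr 2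
        refine Finset.sum_congr rfl fun k hk => ?_
        rw [if_pos (Finset.mem_range.1 hk)]
      · refine Finset.sum_congr rfl fun k hk => ?_
        rw [if_pos (Finset.mem_range.1 hk)]
    rw [inner_sub_right, h2, real_inner_self_eq_norm_sq, h3, ← Finset.sum_sub_distrib]
    exact Finset.sum_congr rfl fun k _ => by ring

/-- Testing the variational inequality of `u` with the residual of `v`, and conversely, shows that
the thresholded tensors and the residuals differ in directions with nonnegative inner product.
Expanding `‖u - v‖²` then gives the bound. -/
theorem norm_tensorSoftThreshold_sub_le (n : Finset (Fin d)) {α : ℝ} (hα : 0 < α)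
    (u v : HilbertTensor H) :
    ‖tensorSoftThreshold n α u - tensorSoftThreshold n α v‖ ≤ ‖u - v‖ := by
  obtain ⟨hu, hu'⟩ := tensorSoftThreshold_variational n hα u
  obtain ⟨hv, hv'⟩ := tensorSoftThreshold_variational n hα v
  have h1 := hu' _ hv
  have h2 := hv' _ hu
  set x := tensorSoftThreshold n α u
  set y := tensorSoftThreshold n α v
  refine le_of_sq_le_sq ?_ (norm_nonneg _)
  have e : u - v = (x - y) + ((u - x) - (v - y)) := by abel
  have h3 : 0 ≤ inner ℝ (x - y) ((u - x) - (v - y)) := by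
    rw [inner_sub_left, inner_sub_right x (u - x), inner_sub_right y (u - x)]
    linarith
  rw [e, norm_add_sq_real]
  nlinarith [sq_nonneg ‖(u - x) - (v - y)‖]

theorem hasRankLE_tensorSoftThreshold (n : Finset (Fin d)) {α : ℝ} (hα : 0 < α)
    (u : HilbertTensor H) : ∃ σ U V r, IsSVD (matricization n u) σ U V ∧
      (∀ k, k < r → α < σ k) ∧ HasRankLE r (matricization n (tensorSoftThreshold n α u)) := by
  obtain ⟨σ, U, V, r, hS, hr, e⟩ := exists_matricization_tensorSoftThreshold n hα u
  refine ⟨σ, U, V, r, hS, fun k => (hr k).2, fun k => U k, fun x => ?_⟩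
  rw [e, sum_apply]
  refine Submodule.sum_mem _ fun k hk => ?_
  rw [smul_apply, rankOne_apply, smul_smul]
  exact Submodule.smul_mem _ _ (Submodule.subset_span ⟨⟨k, Finset.mem_range.1 hk⟩, rfl⟩)

theorem exists_contractions_tensorSoftThreshold (n : Finset (Fin d)) {α : ℝ} (hα : 0 < α)
    (u : HilbertTensor H) :
    (∃ P, ‖P‖ ≤ 1 ∧
      matricization n (tensorSoftThreshold n α u) = P ∘L matricization n u) ∧
    ∃ Q, ‖Q‖ ≤ 1 ∧
      matricization n (tensorSoftThreshold n α u) = matricization n u ∘L Q := by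
  obtain ⟨σ, U, V, r, hS, hr, e⟩ := exists_matricization_tensorSoftThreshold n hα u
  rw [e]
  exact hS.exists_contractions hα hr

end SoftThresholding

/-! ### Thresholding at one edge seen from another edge -/

section LocalContractions

/-- `X` is the operator whose matrix has the entries of `u`, arranged in rows and columns by
`e`. -/
def HasMatrix {I J K : Type*} (e : I × J → K) (u : lp (fun _ : K => ℝ) 2)
    (X : lp (fun _ : J => ℝ) 2 →L[ℝ] lp (fun _ : I => ℝ) 2) : Prop :=
  open Classical in ∀ i l, X (lp.single 2 l (1 : ℝ)) i = u (e (i, l))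

theorem HasMatrix.of_single {I J K : Type*} [DecidableEq J] {e : I × J → K}
    {u : lp (fun _ : K => ℝ) 2} {X : lp (fun _ : J => ℝ) 2 →L[ℝ] lp (fun _ : I => ℝ) 2}
    (h : ∀ i l, X (lp.single 2 l (1 : ℝ)) i = u (e (i, l))) : HasMatrix e u X := by
  obtain rfl : ‹DecidableEq J› = fun a b => Classical.propDecidable (a = b) :=
    Subsingleton.elim _ _
  exact h

/-- `u'` arises from `u` by applying a contraction to the columns of the matrix of `u`. -/
def IsColumnContraction {I J K : Type*} (e : I × J → K) (u u' : lp (fun _ : K => ℝ) 2) : Prop :=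
  ∃ (X X' : lp (fun _ : J => ℝ) 2 →L[ℝ] lp (fun _ : I => ℝ) 2)
    (P : lp (fun _ : I => ℝ) 2 →L[ℝ] lp (fun _ : I => ℝ) 2),
    HasMatrix e u X ∧ HasMatrix e u' X' ∧ ‖P‖ ≤ 1 ∧ X' = P ∘L X

theorem ContinuousLinearMap.ext_lp_single {J S : Type*} [NormedAddCommGroup S] [NormedSpace ℝ S]
    [DecidableEq J] {A B : lp (fun _ : J => ℝ) 2 →L[ℝ] S}
    (h : ∀ l, A (lp.single 2 l (1 : ℝ)) = B (lp.single 2 l (1 : ℝ))) : A = B := by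
  ext1 x
  have hx := lp.hasSum_single (p := 2) (by norm_num) x
  have e : ∀ l, lp.single 2 l (x l) = x l • (lp.single 2 l (1 : ℝ) : lp (fun _ : J => ℝ) 2) :=
    fun l => by rw [← lp.single_smul, smul_eq_mul, mul_one]
  simp only [e] at hx
  have hA := hx.mapL A
  have hB := hx.mapL B
  simp only [map_smul, h] at hA hB
  exact hA.unique hB

theorem HasMatrix.adjoint {I J K : Type*} {e : I × J → K} {u : lp (fun _ : K => ℝ) 2}
    {X : lp (fun _ : J => ℝ) 2 →L[ℝ] lp (fun _ : I => ℝ) 2} (h : HasMatrix e u X) :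
    HasMatrix (fun q : J × I => e q.swap) u (ContinuousLinearMap.adjoint X) := by
  classical
  intro l i
  have hJ : ∀ y : lp (fun _ : J => ℝ) 2, inner ℝ (lp.single 2 l (1 : ℝ)) y = y l := fun y => by
    have := lp.inner_single_left (𝕜 := ℝ) (G := fun _ : J => ℝ) l (1 : ℝ) y
    simpa using this
  have hI : ∀ y : lp (fun _ : I => ℝ) 2, inner ℝ y (lp.single 2 i (1 : ℝ)) = y i := fun y => by
    have := lp.inner_single_left (𝕜 := ℝ) (G := fun _ : I => ℝ) i (1 : ℝ) y
    rw [real_inner_comm]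
    simpa using this
  have h1 := ContinuousLinearMap.adjoint_inner_right X (lp.single 2 l (1 : ℝ))
    (lp.single 2 i (1 : ℝ))
  rw [hJ, hI] at h1
  have h2 := h i l
  simp only [Prod.swap_prod_mk]
  rw [← h2]
  convert h1

theorem hasSum_sq_norm_lp_two {I : Type*} (x : lp (fun _ : I => ℝ) 2) :
    HasSum (fun i => x i ^ 2) (‖x‖ ^ 2) := by
  simpa using lp.hasSum_norm (p := 2) (by norm_num) x

section Lift

variable {I M I' : Type*} (f : I × M ≃ I')

/-- The restriction of a family on `I × M` to `I × {m}`. -/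
def lpSection (x : lp (fun _ : I' => ℝ) 2) (m : M) : lp (fun _ : I => ℝ) 2 :=
  ⟨fun i => x (f (i, m)), memlp_two_iff_summable_sq.2
    (((memlp_two_iff_summable_sq.1 (lp.memℓp x)).comp_injective f.injective).comp_injective
      (i := fun i : I => (i, m)) fun _ _ h => (Prod.ext_iff.1 h).1)⟩

theorem hasSum_sq_norm_lpSection (x : lp (fun _ : I' => ℝ) 2) :
    HasSum (fun m => ‖lpSection f x m‖ ^ 2) (‖x‖ ^ 2) := by
  have h := hasSum_sq_norm_lp_two x
  rw [← ((Equiv.prodComm M I).trans f).hasSum_iff] at h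
  exact h.prod_fiberwise fun m => hasSum_sq_norm_lp_two (lpSection f x m)

variable (P : lp (fun _ : I => ℝ) 2 →L[ℝ] lp (fun _ : I => ℝ) 2)

theorem summable_sq_norm_map_lpSection (x : lp (fun _ : I' => ℝ) 2) :
    Summable fun m => ‖P (lpSection f x m)‖ ^ 2 :=
  Summable.of_nonneg_of_le (fun _ => sq_nonneg _)
    (fun m => by
      rw [← mul_pow]
      exact pow_le_pow_left₀ (norm_nonneg _) (P.le_opNorm _) 2)
    ((hasSum_sq_norm_lpSection f x).summable.mul_left (‖P‖ ^ 2))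

theorem memlp_liftSection (x : lp (fun _ : I' => ℝ) 2) :
    Memℓp (fun k : I' => P (lpSection f x (f.symm k).2) (f.symm k).1) 2 := by
  refine memlp_two_iff_summable_sq.2 (((Equiv.prodComm M I).trans f).summable_iff.1 ?_)
  refine (summable_prod_of_nonneg fun _ => sq_nonneg _).2 ⟨fun m => ?_, ?_⟩
  · simpa using (hasSum_sq_norm_lp_two (P (lpSection f x m))).summable
  · refine (summable_sq_norm_map_lpSection f P x).congr fun m => ?_
    simpa using (hasSum_sq_norm_lp_two (P (lpSection f x m))).tsum_eq.symm

/-- The operator `P ⊗ 1`. -/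
theorem exists_lift_contraction (hP : ‖P‖ ≤ 1) :
    ∃ Q : lp (fun _ : I' => ℝ) 2 →L[ℝ] lp (fun _ : I' => ℝ) 2, ‖Q‖ ≤ 1 ∧
      ∀ x i m, Q x (f (i, m)) = P (lpSection f x m) i := by
  let A : lp (fun _ : I' => ℝ) 2 →ₗ[ℝ] lp (fun _ : I' => ℝ) 2 :=
    { toFun := fun x =>
        ⟨fun k => P (lpSection f x (f.symm k).2) (f.symm k).1, memlp_liftSection f P x⟩
      map_add' := fun x y => by
        ext k
        have : lpSection f (x + y) (f.symm k).2 =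
          lpSection f x (f.symm k).2 + lpSection f y (f.symm k).2 := rfl
        change P (lpSection f (x + y) (f.symm k).2) (f.symm k).1 = _
        rw [this, map_add]
        rfl
      map_smul' := fun c x => by
        ext k
        have : lpSection f (c • x) (f.symm k).2 = c • lpSection f x (f.symm k).2 := rfl
        change P (lpSection f (c • x) (f.symm k).2) (f.symm k).1 = _
        rw [this, map_smul]
        rfl }
  have hA : ∀ x i m, A x (f (i, m)) = P (lpSection f x m) i := by
    intro x i m
    change P (lpSection f x (f.symm (f (i, m))).2) (f.symm (f (i, m))).1 = _
    rw [f.symm_apply_apply]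
  have hn : ∀ x, ‖A x‖ ≤ 1 * ‖x‖ := by
    intro x
    rw [one_mul]
    refine le_of_sq_le_sq ?_ (norm_nonneg _)
    have h1 := hasSum_sq_norm_lpSection f (A x)
    refine hasSum_le (fun m => ?_) h1 (hasSum_sq_norm_lpSection f x)
    have : lpSection f (A x) m = P (lpSection f x m) := by
      ext i
      exact hA x i m
    rw [this]
    exact pow_le_pow_left₀ (norm_nonneg _) (by simpa using P.le_of_opNorm_le hP _) 2
  exact ⟨A.mkContinuous 1 hn, A.mkContinuous_norm_le zero_le_one hn, hA⟩

end Lift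

/-- If the rows `I'` split as `I × M`, each column of the `e'`-matrix is a family over `M` of
columns of the `e`-matrix. Applying `P` to every member is the contraction `P ⊗ 1`. -/
theorem IsColumnContraction.lift {I J K M I' J' : Type*} {e : I × J → K} {e' : I' × J' → K}
    (f : I × M ≃ I') (g : M × J' → J) (hfg : ∀ i m l, e' (f (i, m), l) = e (i, g (m, l)))
    {u u' : lp (fun _ : K => ℝ) 2} (h : IsColumnContraction e u u')
    {Y Y' : lp (fun _ : J' => ℝ) 2 →L[ℝ] lp (fun _ : I' => ℝ) 2} (hY : HasMatrix e' u Y)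
    (hY' : HasMatrix e' u' Y') : ∃ Q, ‖Q‖ ≤ 1 ∧ Y' = Q ∘L Y := by
  classical
  obtain ⟨X, X', P, hX, hX', hP, rfl⟩ := h
  obtain ⟨Q, hQ, hQP⟩ := exists_lift_contraction f P hP
  refine ⟨Q, hQ, ContinuousLinearMap.ext_lp_single fun l => ?_⟩
  ext k
  obtain ⟨⟨i, m⟩, rfl⟩ := f.surjective k
  have h1 := hY' (f (i, m)) l
  have h2 := hX' i (g (m, l))
  have h3 : lpSection f (Y (lp.single 2 l (1 : ℝ))) m =
      X (lp.single 2 (g (m, l)) (1 : ℝ)) := by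
    ext i
    have h4 := hY (f (i, m)) l
    have h5 := hX i (g (m, l))
    rw [hfg, ← h5] at h4
    exact h4
  rw [ContinuousLinearMap.comp_apply, hQP, h3]
  rw [hfg, ← h2] at h1
  exact h1

section Merge

variable {ι : Type*} {Z : ι → Type*}

/-- Combine families on two complementary sets of indices. -/
def mergePi (p p' : ι → Prop) [DecidablePred p] (hp : ∀ j, p' j ↔ ¬ p j)
    (q : (∀ j : {j // p j}, Z j) × (∀ j : {j // p' j}, Z j)) : ∀ j, Z j :=
  fun j => if h : p j then q.1 ⟨j, h⟩ else q.2 ⟨j, (hp j).2 h⟩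

/-- Split a family on `q` into its parts on `p` and on `q \ p`. -/
def splitPi (p q : ι → Prop) [DecidablePred p] (hpq : ∀ j, p j → q j) :
    ((∀ j : {j // p j}, Z j) × (∀ j : {j // q j ∧ ¬ p j}, Z j)) ≃ ∀ j : {j // q j}, Z j where
  toFun x j := if h : p j then x.1 ⟨j, h⟩ else x.2 ⟨j, j.2, h⟩
  invFun y := (fun j => y ⟨j, hpq j j.2⟩, fun j => y ⟨j, j.2.1⟩)
  left_inv x := by
    refine Prod.ext ?_ ?_
    · funext j
      simp [j.2]
    · funext j
      simp [j.2.2]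
  right_inv y := by
    funext j
    by_cases h : p j <;> simp [h]

/-- For `p ⊆ q` the rows over `q` split into `p` and `q \ p`, and the latter join `q'` to form the
column index over `p'`. Complements are separate predicates so that the transposed matrices, with
`∉` and `∈` exchanged, are covered too. -/
theorem IsColumnContraction.lift_mergePi {p p' q q' : ι → Prop} [DecidablePred p]
    [DecidablePred q] (hp : ∀ j, p' j ↔ ¬ p j) (hq : ∀ j, q' j ↔ ¬ q j) (hpq : ∀ j, p j → q j)
    {u u' : lp (fun _ : (∀ j, Z j) => ℝ) 2} (h : IsColumnContraction (mergePi p p' hp) u u')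
    {Y Y' : lp (fun _ : (∀ j : {j // q' j}, Z j) => ℝ) 2 →L[ℝ]
      lp (fun _ : (∀ j : {j // q j}, Z j) => ℝ) 2} (hY : HasMatrix (mergePi q q' hq) u Y)
    (hY' : HasMatrix (mergePi q q' hq) u' Y') : ∃ Q, ‖Q‖ ≤ 1 ∧ Y' = Q ∘L Y := by
  refine h.lift (splitPi p q hpq) (fun (x : (∀ j : {j // q j ∧ ¬ p j}, Z j) ×
    (∀ j : {j // q' j}, Z j)) (j : {j // p' j}) => if hj : q j then x.1 ⟨j, hj, (hp j).1 j.2⟩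
    else x.2 ⟨j, (hq j).2 hj⟩) (fun i m l => ?_) hY hY'
  funext j
  by_cases h1 : p j
  · simp [mergePi, splitPi, h1, hpq j h1]
  · by_cases h2 : q j <;> simp [mergePi, splitPi, h1, h2]

end Merge

variable {d : ℕ} {H : Fin d → Type*} [∀ j, NormedAddCommGroup (H j)]
    [∀ j, InnerProductSpace ℝ (H j)] [∀ j, CompleteSpace (H j)]

theorem hasMatrix_matricization (n : Finset (Fin d)) (u : HilbertTensor H) :
    HasMatrix (mergePi (· ∈ n) (· ∉ n) fun _ => Iff.rfl) u (matricization n u) := by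
  classical
  exact HasMatrix.of_single fun k l => matricization_single n u k l

theorem hasMatrix_adjoint_matricization (n : Finset (Fin d)) (u : HilbertTensor H) :
    HasMatrix (mergePi (· ∉ n) (· ∈ n) fun _ => not_not.symm) u
      (ContinuousLinearMap.adjoint (matricization n u)) := by
  have e : (mergePi (Z := fun j => onbIndex (H j)) (· ∉ n) (· ∈ n) fun _ => not_not.symm) =
      fun q => mergePi (· ∈ n) (· ∉ n) (fun _ => Iff.rfl) q.swap := by
    funext q j
    by_cases h : j ∈ n <;> simp [mergePi, h]
  rw [e]
  exact (hasMatrix_matricization n u).adjoint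

theorem isColumnContraction_tensorSoftThreshold (n : Finset (Fin d)) {α : ℝ} (hα : 0 < α)
    (u : HilbertTensor H) :
    IsColumnContraction (mergePi (· ∈ n) (· ∉ n) fun _ => Iff.rfl) u
      (tensorSoftThreshold n α u) := by
  obtain ⟨⟨P, hP, e⟩, -⟩ := exists_contractions_tensorSoftThreshold n hα u
  exact ⟨_, _, P, hasMatrix_matricization n u, hasMatrix_matricization n _, hP, e⟩

theorem isColumnContraction_tensorSoftThreshold_compl (n : Finset (Fin d)) {α : ℝ} (hα : 0 < α)
    (u : HilbertTensor H) :
    IsColumnContraction (mergePi (· ∉ n) (· ∈ n) fun _ => not_not.symm) u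
      (tensorSoftThreshold n α u) := by
  obtain ⟨-, Q, hQ, e⟩ := exists_contractions_tensorSoftThreshold n hα u
  refine ⟨_, _, ContinuousLinearMap.adjoint Q, hasMatrix_adjoint_matricization n u,
    hasMatrix_adjoint_matricization n _, ?_, ?_⟩
  · rwa [LinearIsometryEquiv.norm_map]
  · rw [e, ContinuousLinearMap.adjoint_comp]

/-- Two edges of a tree: up to complements, one side of one edge is contained in a side of the
other. -/
def IsLaminar (s t : Finset (Fin d)) : Prop :=
  s ⊆ t ∨ s ⊆ tᶜ ∨ sᶜ ⊆ t ∨ sᶜ ⊆ tᶜ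

/-- Soft thresholding at the edge `s` is a contraction on rows or columns at every other
edge. -/
theorem exists_contraction_matricization_tensorSoftThreshold {s t : Finset (Fin d)}
    (hst : IsLaminar s t) {α : ℝ} (hα : 0 < α) (u : HilbertTensor H) :
    (∃ P, ‖P‖ ≤ 1 ∧ matricization t (tensorSoftThreshold s α u) = P ∘L matricization t u) ∨
      ∃ Q, ‖Q‖ ≤ 1 ∧ matricization t (tensorSoftThreshold s α u) = matricization t u ∘L Q := by
  have hadj : (∃ P, ‖P‖ ≤ 1 ∧
      ContinuousLinearMap.adjoint (matricization t (tensorSoftThreshold s α u)) =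
        P ∘L ContinuousLinearMap.adjoint (matricization t u)) →
      ∃ Q, ‖Q‖ ≤ 1 ∧ matricization t (tensorSoftThreshold s α u) = matricization t u ∘L Q := by
    rintro ⟨P, hP, e⟩
    refine ⟨ContinuousLinearMap.adjoint P, by rwa [LinearIsometryEquiv.norm_map], ?_⟩
    have := congrArg ContinuousLinearMap.adjoint e
    rwa [ContinuousLinearMap.adjoint_comp, ContinuousLinearMap.adjoint_adjoint,
      ContinuousLinearMap.adjoint_adjoint] at this
  have h1 := isColumnContraction_tensorSoftThreshold s hα u
  have h2 := isColumnContraction_tensorSoftThreshold_compl s hα u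
  -- The side of `s` contained in a side of `t` decides which contraction of the thresholding is
  -- used; containment in `tᶜ` is treated through adjoints and yields a contraction on the right.
  rcases hst with h | h | h | h
  · exact Or.inl (h1.lift_mergePi _ _ (fun j hj => h hj) (hasMatrix_matricization t u)
      (hasMatrix_matricization t _))
  · exact Or.inr (hadj (h1.lift_mergePi _ _ (fun j hj => Finset.mem_compl.1 (h hj))
      (hasMatrix_adjoint_matricization t u) (hasMatrix_adjoint_matricization t _)))
  · exact Or.inl (h2.lift_mergePi _ _ (fun j hj => h (Finset.mem_compl.2 hj))
      (hasMatrix_matricization t u) (hasMatrix_matricization t _))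
  · exact Or.inr (hadj (h2.lift_mergePi _ _
      (fun j hj => Finset.mem_compl.1 (h (Finset.mem_compl.2 hj)))
      (hasMatrix_adjoint_matricization t u) (hasMatrix_adjoint_matricization t _)))

end LocalContractions

/-! ### Tree nodes are nested or disjoint -/

section Trees

variable {d : ℕ}

theorem IsDimensionTree.subset_root {r : Finset (Fin d)} {T : Finset (Finset (Fin d))}
    (h : IsDimensionTree r T) : ∀ m ∈ T, m ⊆ r := by
  induction h with
  | leaf i => simp
  | node ha hb hab iha ihb =>
    intro m hm
    simp only [Finset.mem_insert, Finset.mem_union] at hm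
    rcases hm with rfl | hm | hm
    · exact subset_rfl
    · exact (iha m hm).trans Finset.subset_union_left
    · exact (ihb m hm).trans Finset.subset_union_right

theorem IsDimensionTree.laminar {r : Finset (Fin d)} {T : Finset (Finset (Fin d))}
    (h : IsDimensionTree r T) :
    ∀ m ∈ T, ∀ m' ∈ T, m ⊆ m' ∨ m' ⊆ m ∨ Disjoint m m' := by
  induction h with
  | leaf i =>
    intro m hm m' hm'
    rw [Finset.mem_singleton.1 hm, Finset.mem_singleton.1 hm']
    exact Or.inl subset_rfl
  | @node a b A B ha hb hab iha ihb =>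
    have ht := (ha.node hb hab).subset_root
    intro m hm m' hm'
    by_cases e : m = a ∪ b
    · exact Or.inr (Or.inl (e ▸ ht m' hm'))
    by_cases e' : m' = a ∪ b
    · exact Or.inl (e' ▸ ht m hm)
    simp only [Finset.mem_insert, Finset.mem_union, e, e', false_or] at hm hm'
    rcases hm with hm | hm <;> rcases hm' with hm' | hm'
    · exact iha m hm m' hm'
    · exact Or.inr (Or.inr (hab.mono (ha.subset_root m hm) (hb.subset_root m' hm')))
    · exact Or.inr (Or.inr (hab.symm.mono (hb.subset_root m hm) (ha.subset_root m' hm')))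
    · exact ihb m hm m' hm'

theorem IsEdgeEnumeration.exists_node {E : ℕ} {T : Finset (Finset (Fin d))}
    {n : Fin E → Finset (Fin d)} (h : IsEdgeEnumeration T n) (t : Fin E) :
    ∃ m ∈ T, n t = m ∨ n t = mᶜ := by
  have h1 := h.mapsTo (Set.mem_univ t)
  simp only [treeEdges, Finset.coe_image, Set.mem_image, Finset.mem_coe, Finset.mem_erase] at h1
  obtain ⟨m, ⟨-, hm⟩, e⟩ := h1
  have h2 : n t ∈ ({m, mᶜ} : Finset (Finset (Fin d))) := by rw [e]; simp
  exact ⟨m, hm, by simpa using h2⟩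

/-- An edge determines its node only up to complement; `IsLaminar` is invariant under complements,
so nestedness or disjointness of the nodes suffices. -/
theorem IsEdgeEnumeration.isLaminar {E : ℕ} {T : Finset (Finset (Fin d))} {r : Finset (Fin d)}
    (hT : IsDimensionTree r T) {n : Fin E → Finset (Fin d)} (h : IsEdgeEnumeration T n)
    (s t : Fin E) : IsLaminar (n s) (n t) := by
  obtain ⟨a, ha, hs⟩ := h.exists_node s
  obtain ⟨b, hb, ht⟩ := h.exists_node t
  have h0 := hT.laminar a ha b hb
  rw [← Finset.subset_compl_iff_disjoint_right] at h0
  have h1 : b ⊆ a → aᶜ ⊆ bᶜ := Finset.compl_subset_compl.2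
  unfold IsLaminar
  rcases hs with hs | hs <;> rcases ht with ht | ht <;> rw [hs, ht] <;>
    (try simp only [compl_compl]) <;> tauto

end Trees

/-! ### Composition over all edges and the rank bound -/

section HierarchicalThresholding

variable {d : ℕ} {H : Fin d → Type*} [∀ j, NormedAddCommGroup (H j)]
    [∀ j, InnerProductSpace ℝ (H j)] [∀ j, CompleteSpace (H j)]

/-- Soft thresholding at the edges of a list. -/
def listSoftThreshold {E : ℕ} (n : Fin E → Finset (Fin d)) (α : ℝ) (l : List (Fin E))
    (u : HilbertTensor H) : HilbertTensor H :=
  l.foldl (fun w t => tensorSoftThreshold (n t) α w) u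

variable {E : ℕ} {n : Fin E → Finset (Fin d)} {α : ℝ}

theorem norm_listSoftThreshold_sub_le (hα : 0 < α) (l : List (Fin E)) (u v : HilbertTensor H) :
    ‖listSoftThreshold n α l u - listSoftThreshold n α l v‖ ≤ ‖u - v‖ := by
  induction l generalizing u v with
  | nil => exact le_rfl
  | cons s l ih => exact (ih _ _).trans (norm_tensorSoftThreshold_sub_le (n s) hα u v)

theorem isApproxBy_listSoftThreshold (hα : 0 < α) {t : Fin E}
    (hn : ∀ s, IsLaminar (n s) (n t)) {m : ℕ} {τ : ℝ} (hτ : 0 ≤ τ) (l : List (Fin E))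
    {u : HilbertTensor H} (hu : IsApproxBy m τ (matricization (n t) u)) :
    IsApproxBy m τ (matricization (n t) (listSoftThreshold n α l u)) := by
  induction l generalizing u with
  | nil => exact hu
  | cons s l ih =>
    refine ih (u := tensorSoftThreshold (n s) α u) ?_
    rcases exists_contraction_matricization_tensorSoftThreshold (hn s) hα u with
      ⟨P, hP, e⟩ | ⟨Q, hQ, e⟩
    · rw [e]
      exact hu.comp_left hP
    · rw [e]
      exact hu.comp_right hτ hQ

theorem hasRankLE_listSoftThreshold (hα : 0 < α) {t : Fin E}
    (hn : ∀ s, IsLaminar (n s) (n t)) {r : ℕ} (l : List (Fin E)) {u : HilbertTensor H}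
    (hu : HasRankLE r (matricization (n t) u)) :
    HasRankLE r (matricization (n t) (listSoftThreshold n α l u)) := by
  induction l generalizing u with
  | nil => exact hu
  | cons s l ih =>
    refine ih (u := tensorSoftThreshold (n s) α u) ?_
    rcases exists_contraction_matricization_tensorSoftThreshold (hn s) hα u with
      ⟨P, -, e⟩ | ⟨Q, -, e⟩
    · rw [e]
      exact hu.comp_left P
    · rw [e]
      exact hu.comp_right Q

/-- If at most `m` singular values of `v` exceed `α / 2`, then thresholding of `w` leaves at most
`m + 4 ‖v - w‖² / α²` singular values. -/
theorem hasRankLE_tensorSoftThreshold_of_isApproxBy (N : Finset (Fin d)) (hα : 0 < α)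
    {v w : HilbertTensor H} {ε : ℝ} (hvw : ‖v - w‖ ≤ ε) {m : ℕ}
    (hv : IsApproxBy m (α / 2) (matricization N v)) :
    ∃ r : ℕ, HasRankLE r (matricization N (tensorSoftThreshold N α w)) ∧
      (r : ℝ) ≤ 4 * ε ^ 2 / α ^ 2 + m := by
  obtain ⟨σ, U, V, r, hS, hr, hrank⟩ := hasRankLE_tensorSoftThreshold N hα w
  refine ⟨r, hrank, ?_⟩
  obtain ⟨s, x, hs, hx, hle⟩ := hS.exists_orthonormal_le_norm_sub hα hr hv
  have h1 := sum_norm_sq_matricization_le N (w - v) hx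
  -- Each of the `s` orthonormal vectors contributes at least `(α - α / 2)²` to the squared
  -- Hilbert-Schmidt norm of the difference.
  have h2 : (s : ℝ) * (α / 2) ^ 2 ≤ ε ^ 2 := by
    calc (s : ℝ) * (α / 2) ^ 2 = ∑ _i : Fin s, (α / 2) ^ 2 := by simp
      _ ≤ ∑ i, ‖matricization N (w - v) (x i)‖ ^ 2 := by
        refine Finset.sum_le_sum fun i _ => pow_le_pow_left₀ (by positivity) ?_ 2
        have := hle i
        rw [← matricizationL_apply, map_sub, sub_apply]
        rw [sub_half] at this
        exact this
      _ ≤ ‖w - v‖ ^ 2 := h1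
      _ ≤ ε ^ 2 := by
        rw [norm_sub_rev]
        exact pow_le_pow_left₀ (norm_nonneg _) hvw 2
  have h3 : (s : ℝ) ≤ 4 * ε ^ 2 / α ^ 2 := by
    rw [le_div_iff₀ (by positivity)]
    linarith
  have h4 : (r : ℝ) ≤ s + m := by exact_mod_cast hs
  linarith

/-- The rank bound in terms of the number of singular values of `v` exceeding `α / 2`. -/
theorem exists_tensorRank_hierSoftThreshold {T : Finset (Finset (Fin d))} {R : Finset (Fin d)}
    (hT : IsDimensionTree R T) (hn : IsEdgeEnumeration T n) (hα : 0 < α) {v w : HilbertTensor H}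
    {ε : ℝ} (hvw : ‖v - w‖ ≤ ε) (t : Fin E) : ∃ m r : ℕ,
      (∀ k, k < m → α / 2 < tensorSingularValues (n t) v k) ∧
      tensorRank (n t) (hierSoftThreshold n α w) = r ∧ (r : ℝ) ≤ 4 * ε ^ 2 / α ^ 2 + m := by
  obtain ⟨U, V, hS⟩ := isSVD_singularValues (n t) v
  obtain ⟨m, hm⟩ := hS.exists_lt_iff (half_pos hα)
  have hlam := fun s => hn.isLaminar hT s t
  -- The edges are split around `t`: `l₁` is handled by approximability and nonexpansiveness, `l₂`
  -- by rank.
  obtain ⟨l₁, l₂, hl⟩ := List.append_of_mem (List.mem_finRange t)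
  have hv1 := isApproxBy_listSoftThreshold hα hlam (half_pos hα).le l₁
    (hS.isApproxBy (half_pos hα).le fun k hk =>
      not_lt.1 fun h => absurd ((hm k).1 h) (not_lt.2 hk))
  obtain ⟨r, hr, hle⟩ := hasRankLE_tensorSoftThreshold_of_isApproxBy (n t) hα
    ((norm_listSoftThreshold_sub_le hα l₁ v w).trans hvw) hv1
  have e : hierSoftThreshold n α w = listSoftThreshold n α l₂
      (tensorSoftThreshold (n t) α (listSoftThreshold n α l₁ w)) := by
    rw [hierSoftThreshold, hl, List.foldl_append]
    rfl
  have h1 : tensorRank (n t) (hierSoftThreshold n α w) ≤ r := by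
    rw [e]
    exact (hasRankLE_listSoftThreshold hα hlam l₂ hr).opRank_le
  obtain ⟨r', hr'⟩ := ENat.ne_top_iff_exists.1 (ne_top_of_le_ne_top (ENat.natCast_ne_top r) h1)
  refine ⟨m, r', fun k => (hm k).2, hr'.symm, le_trans ?_ hle⟩
  rw [← hr'] at h1
  exact_mod_cast h1

end HierarchicalThresholding

/-! ### Counting singular values above a threshold -/

section Counting

theorem mul_rpow_le_weakLpNorm {p τ : ℝ} (hp : 0 < p) (hτ : 0 < τ) {a : ℕ → ℝ} {m : ℕ}
    (hm : ∀ k, k < m → τ < a k) (ha : MemWeakLp p a) :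
    (m : ℝ) * τ ^ p ≤ (weakLpNorm p a).toReal ^ p := by
  rcases m with _ | m
  · simp only [Nat.cast_zero, zero_mul]
    positivity
  -- Here `m + 1` entries exceed `τ`. Since `rearrangement` counts from zero, its index `m` is the
  -- last one forced to be at least `τ`.
  have h1 : ENNReal.ofReal τ ≤ rearrangement a m := by
    refine le_sInf fun s hs => ?_
    by_contra! hlt
    have h2 : (Set.Iio (m + 1)) ⊆ {k | s < ENNReal.ofReal |a k|} := fun k hk =>
      hlt.trans_le (ENNReal.ofReal_le_ofReal ((hm k hk).le.trans (le_abs_self _)))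
    have h3 := (Set.encard_le_encard h2).trans hs
    have h4 : (Set.Iio (m + 1)).encard = ((m + 1 : ℕ) : ℕ∞) := by
      rw [← Finset.coe_Iio, Set.encard_coe_eq_coe_finsetCard, Nat.card_Iio]
    rw [h4] at h3
    have : m + 1 ≤ m := by exact_mod_cast h3
    omega
  have h2 : ((m + 1 : ℕ) : ℝ≥0∞) ^ (1 / p) * ENNReal.ofReal τ ≤ weakLpNorm p a :=
    (mul_le_mul_right h1 _).trans
      (le_iSup (fun n : ℕ => ((n + 1 : ℕ) : ℝ≥0∞) ^ (1 / p) * rearrangement a n) m)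
  have h3 := ENNReal.toReal_mono (ne_of_lt ha) h2
  rw [ENNReal.toReal_mul, ENNReal.toReal_ofReal hτ.le, ← ENNReal.toReal_rpow,
    ENNReal.toReal_natCast] at h3
  have h4 := Real.rpow_le_rpow (by positivity) h3 hp.le
  rwa [Real.mul_rpow (by positivity) hτ.le, ← Real.rpow_mul (by positivity),
    one_div_mul_cancel hp.ne', Real.rpow_one] at h4

/-- The decay bound is used only at the last large index: for `m > 0` it gives `α / 2 < C exp (-c m
^ β)`, which is solved for `m`. -/
theorem natCast_le_of_lt_exp {C c β α : ℝ} (hC : 0 < C) (hc : 0 < c) (hβ : 0 < β) (hα : 0 < α)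
    {a : ℕ → ℝ} {m : ℕ} (hm : ∀ k, k < m → α / 2 < a k)
    (ha : ∀ k : ℕ, a k ≤ C * Real.exp (-c * ((k + 1 : ℕ) : ℝ) ^ β)) :
    (m : ℝ) ≤ (c⁻¹ * max (Real.log (2 * C * α⁻¹)) 0) ^ (1 / β) := by
  rcases m with _ | m
  · rw [Nat.cast_zero]
    positivity
  set M : ℝ := ((m + 1 : ℕ) : ℝ) with hM
  have h1 : α / 2 < C * Real.exp (-c * M ^ β) := (hm m m.lt_succ_self).trans_le (ha m)
  have h2 : Real.exp (c * M ^ β) ≤ 2 * C * α⁻¹ := by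
    have h3 : Real.exp (-c * M ^ β) = (Real.exp (c * M ^ β))⁻¹ := by
      rw [← Real.exp_neg, neg_mul]
    rw [h3, ← div_eq_mul_inv, lt_div_iff₀ (Real.exp_pos _)] at h1
    rw [← div_eq_mul_inv, le_div_iff₀ hα]
    linarith
  have h3 : c * M ^ β ≤ Real.log (2 * C * α⁻¹) :=
    (Real.le_log_iff_exp_le (by positivity)).2 h2
  have h4 : M ^ β ≤ c⁻¹ * max (Real.log (2 * C * α⁻¹)) 0 := by
    rw [inv_mul_eq_div, le_div_iff₀ hc, mul_comm]
    exact h3.trans (le_max_left _ _)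
  have h5 := Real.rpow_le_rpow (by positivity) h4 (by positivity : 0 ≤ 1 / β)
  rwa [← Real.rpow_mul (by positivity), mul_one_div_cancel hβ.ne', Real.rpow_one] at h5

end Counting

end

theorem lemma3p5 :
    (∀ p : ℝ, 0 < p → p < 2 → ∃ Cp : ℝ, 0 < Cp ∧
      ∀ (d E : ℕ) (_ : 2 ≤ d)
        (H : Fin d → Type*) [∀ j, NormedAddCommGroup (H j)] [∀ j, InnerProductSpace ℝ (H j)]
        [∀ j, CompleteSpace (H j)] [∀ j, TopologicalSpace.SeparableSpace (H j)]
        (T : Finset (Finset (Fin d))) (_ : IsDimensionTree Finset.univ T)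
        (n : Fin E → Finset (Fin d)) (_ : IsEdgeEnumeration T n)
        (v w : HilbertTensor H) (ε α : ℝ) (_ : 0 < ε) (_ : 0 < α) (_ : ‖v - w‖ ≤ ε) (t : Fin E),
        MemWeakLp p (tensorSingularValues (n t) v) →
        ∃ r : ℕ, tensorRank (n t) (hierSoftThreshold n α w) = r ∧
          (r : ℝ) ≤ 4 * ε ^ 2 / α ^ 2 +
            Cp * (weakLpNorm p (tensorSingularValues (n t) v)).toReal ^ p * α ^ (-p)) ∧
    (∀ (d E : ℕ) (_ : 2 ≤ d)
        (H : Fin d → Type*) [∀ j, NormedAddCommGroup (H j)] [∀ j, InnerProductSpace ℝ (H j)]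
        [∀ j, CompleteSpace (H j)] [∀ j, TopologicalSpace.SeparableSpace (H j)]
        (T : Finset (Finset (Fin d))) (_ : IsDimensionTree Finset.univ T)
        (n : Fin E → Finset (Fin d)) (_ : IsEdgeEnumeration T n)
        (v w : HilbertTensor H) (ε α : ℝ) (_ : 0 < ε) (_ : 0 < α) (_ : ‖v - w‖ ≤ ε) (t : Fin E)
        (C c β : ℝ) (_ : 0 < C) (_ : 0 < c) (_ : 0 < β),
        (∀ k : ℕ, tensorSingularValues (n t) v k ≤ C * Real.exp (-c * ((k + 1 : ℕ) : ℝ) ^ β)) →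
        ∃ r : ℕ, tensorRank (n t) (hierSoftThreshold n α w) = r ∧
          (r : ℝ) ≤ 4 * ε ^ 2 / α ^ 2 +
            (c⁻¹ * max (Real.log (2 * C * α⁻¹)) 0) ^ (1 / β)) := by
  -- The constant comes from counting at level `α / 2`, as `(α / 2) ^ (-p) = 2 ^ p * α ^ (-p)`.
  refine ⟨fun p hp _ => ⟨2 ^ p, by positivity, ?_⟩, ?_⟩
  · intro d E _ H _ _ _ _ T hT n hn v w ε α _ hα hvw t ht
    obtain ⟨m, r, hm, hr, hle⟩ := exists_tensorRank_hierSoftThreshold hT hn hα hvw t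
    refine ⟨r, hr, hle.trans (add_le_add_right ?_ _)⟩
    have h1 := mul_rpow_le_weakLpNorm hp (half_pos hα) hm ht
    rw [Real.div_rpow hα.le zero_le_two, mul_div_assoc', div_le_iff₀ (by positivity)] at h1
    rw [Real.rpow_neg hα.le, ← div_eq_mul_inv, le_div_iff₀ (by positivity)]
    linarith
  · intro d E _ H _ _ _ _ T hT n hn v w ε α _ hα hvw t C c β hC hc hβ hdecay
    obtain ⟨m, r, hm, hr, hle⟩ := exists_tensorRank_hierSoftThreshold hT hn hα hvw t
    exact ⟨r, hr, hle.trans (add_le_add_right (natCast_le_of_lt_exp hC hc hβ hα hm hdecay) _)⟩
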